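/- Let $\Bbbk$ be a field and $Q$ a (nonempty) quiver, possibly infinite, that is connected as a graph. The path coalgebra $\Bbbk Q$ has the paths of $Q$ as a basis, with $\Delta(p)=\sum_{p=rq} r\otimes q$ (the sum over all ways to write $p$ as a path $q$ followed by a path $r$, trivial ones included) and $\varepsilon(p)=\delta_{|p|,0}$. Let $B\subseteq \Bbbk Q$ be an admissible subcoalgebra, i.e. one that contains all vertices and arrows of $Q$. Definitions. Let $B(x,y)$ be the set of elements of $B$ that are combinations of paths from $x$ to $y$. An element $b=\sum_{i\in I}\lambda_ip_i\in B(x,y)$ with distinct paths $p_i$ and $\lambda_i\neq 0$ is *minimal* if $|I|\ge 2$ and $\sum_{i\in I'}\lambda_ip_i\notin B(x,y)$ for all nonempty proper $I'\subset I$. Write $p\sim q$ if $p\ne q$ occur in a common minimal element. For a vertex $x_0$, $\pi_1(Q,x_0)$ is the group of homotopy classes of closed walks at $x_0$, and $N(B,x_0)$ is its normal subgroup generated by the classes of all $w^{-1}p^{-1}qw$ with $p\sim q$ paths from $x$ to $y$ and $w$ a walk from $x_0$ to $x$. A *Galois covering of quivers* $F:Q'\to Q$ is a surjective morphism of connected quivers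 that is bijective on the arrows starting, and on the arrows ending, at each vertex, such that $F_*(\pi_1(Q',x'))$ is normal in $\pi_1(Q,F(x'))$. A *lifting* of $F$ is a map $L:Q_0\to Q'_0$ with $FL=\mathrm{id}$; for a path $p$, $L(p)$ is the unique path over $p$ starting at $L(s(p))$, and $L$ is extended linearly to $\Bbbk Q$. A *Galois coalgebra covering* $F:B'\to B$ is the restriction of (the map $\Bbbk Q'\to\Bbbk Q$ induced by) a Galois covering of quivers $F:Q'\to Q$, where $B'\subseteq \Bbbk Q'$ is the span of all $L(b)$ with $L$ a lifting and $b\in B$ a minimal element or a path, and where for each minimal element $b\in B(x,y)$ and each vertex $x'$ over $x$ there are a vertex $y'$ and a minimal element $b'\in B'(x',y')$ with $F(b')=b$. A morphism from a coalgebra covering $F:B'\to B$ to $F_1:B_1\to B$ is a quiver morphism $\theta:Q'\to Q_1$ with $F_1\theta=F$ and $\theta(B')\subseteq B_1$. Fix $x_0\in Q_0$, put $G=\pi_1(Q,x_0)/N(B,x_0)$, choose a walk $c_x$ from $x_0$ to each vertex $x$, and let $\delta(a)\in G$ be the class of $c_y^{-1}ac_x$ for each arrow $a:x\to y$, extended to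 paths by $\delta(rq)=\delta(r)\delta(q)$. The quiver $Q\rtimes G$ has vertices $x\rtimes g$ and arrows $a\rtimes g$ from $s(a)\rtimes g$ to $t(a)\rtimes\delta(a)g$. Its path coalgebra is identified with the smash coproduct $\Bbbk Q\rtimes\Bbbk G$, which has basis $p\rtimes g$, $\Delta(p\rtimes g)=\sum_{p=rq}(r\rtimes\delta(q)g)\otimes(q\rtimes g)$ and $\varepsilon(p\rtimes g)=\varepsilon(p)$; here the path of $Q\rtimes G$ over $p$ that starts at $s(p)\rtimes g$ corresponds to $p\rtimes g$. Let $\tilde B=B\rtimes\Bbbk G$ be the span of all $b\rtimes g$ with $b\in B$, $g\in G$, and let $F:Q\rtimes G\to Q$, $u\rtimes g\mapsto u$. Theorem. $B$ is homogeneous for the grading of $\Bbbk Q$ by $\delta$, $\tilde B$ is an admissible subcoalgebra of $\Bbbk(Q\rtimes G)$, and: (a) $F:\tilde B\to B$ is a Galois coalgebra covering, and for every Galois coalgebra covering $F':B'\to B$ there is a Galois coalgebra covering $E:\tilde B\to B'$ with $F'E=F$. (b) For every Galois coalgebra covering $F':B'\to B$ with underlying quiver covering $F':Q'\to Q$ and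 all vertices $\tilde x$ of $Q\rtimes G$ and $x'$ of $Q'$ with $F(\tilde x)=F'(x')$, there is exactly one Galois coalgebra covering $E:\tilde B\to B'$ with $F'E=F$ and $E(\tilde x)=x'$. (c) Every Galois coalgebra covering of $B$ that has the property in (a) is isomorphic, as a coalgebra covering of $B$, to $F:\tilde B\to B$. -/

import Mathlib

open CategoryTheory Quiver
open scoped TensorProduct

universe u v w w' z

noncomputable section

namespace PathCoalg

/-! ### Paths and the path coalgebra -/

section PathCoalgebra

variable {V : Type u} [Quiver.{v} V]

/-- All (directed) paths of a quiver, bundled with their source and target. Mathlib writes paths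
from left to right: in `q.comp r` the path `q` is run first. -/
abbrev AllPaths (V : Type u) [Quiver.{v} V] := Σ x : V, Σ y : V, Path x y

/-- Bundling of a path. -/
abbrev toAll {x y : V} (p : Path x y) : AllPaths V := ⟨x, y, p⟩

/-- The list of all ways to cut `p : x → y` into `q : x → m` followed by `r : m → y`
(the trivial cuts included). -/
def splits {x : V} : {y : V} → Path x y → List (Σ m : V, Path x m × Path m y)
  | _, .nil => [⟨x, .nil, .nil⟩]
  | y, .cons p a => ⟨y, .cons p a, .nil⟩ :: (splits p).map fun d => ⟨d.1, d.2.1, d.2.2.cons a⟩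

theorem mem_splits {x y : V} (p : Path x y) (d : Σ m : V, Path x m × Path m y) :
    d ∈ splits p ↔ d.2.1.comp d.2.2 = p := by
  induction p with
  | nil =>
    obtain ⟨m, q, r⟩ := d
    constructor
    · intro h
      simp only [splits, List.mem_singleton] at h
      cases h
      rfl
    · intro h
      cases r with
      | nil => cases q with
        | nil => simp [splits]
        | cons q a => simp at h
      | cons r a => simp at h
  | cons p a ih =>
    obtain ⟨m, q, r⟩ := d
    simp only [splits, List.mem_cons, List.mem_map]
    constructor
    · rintro (h | ⟨d, hd, h⟩)
      · cases h
        rfl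
      · cases h
        simp [(ih d).1 hd]
    · intro h
      cases r with
      | nil =>
        left
        simp only [Path.comp_nil] at h
        rw [h]
      | cons r b =>
        right
        simp only [Path.comp_cons] at h
        cases h
        exact ⟨⟨m, q, r⟩, (ih _).2 rfl, rfl⟩

theorem splits_nodup {x y : V} (p : Path x y) : (splits p).Nodup := by
  induction p with
  | nil => simp [splits]
  | cons p a ih =>
    simp only [splits, List.nodup_cons, List.mem_map, not_exists, not_and]
    refine ⟨?_, ih.map ?_⟩
    · intro d _ h
      have := congrArg (fun e => e.2.2.length) h
      simp at this
    · rintro ⟨m, q, r⟩ ⟨m', q', r'⟩ h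
      simp only [Sigma.mk.injEq] at h
      obtain ⟨rfl, h⟩ := h
      simp only [heq_eq_eq, Prod.mk.injEq] at h
      obtain ⟨rfl, h⟩ := h
      cases h
      rfl

/-- Cutting a path into three pieces can be done in either order. -/
theorem splits_coassoc {M : Type*} [AddCommMonoid M] {x y : V} (p : Path x y)
    (f : ∀ m n : V, Path x m → Path m n → Path n y → M) :
    ((splits p).map fun d => ((splits d.2.2).map fun e => f d.1 e.1 d.2.1 e.2.1 e.2.2).sum).sum =
    ((splits p).map fun d => ((splits d.2.1).map fun e => f e.1 d.1 e.2.1 e.2.2 d.2.2).sum).sum := by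
  induction p with
  | nil => simp [splits]
  | cons p a ih =>
    have := ih (fun m n q s r => f m n q s (r.cons a))
    simp only [splits, List.map_cons, List.sum_cons, List.map_map, Function.comp_def,
      List.sum_map_add, List.map_nil, List.sum_nil, add_zero, this]
    abel

end PathCoalgebra

section PathCoalgebra

variable (k : Type z) [Field k] (V : Type u) [Quiver.{v} V]

/-- The path coalgebra `k Q`: the vector space on all paths. -/
def PathCoalgebra : Type (max z u v) := AllPaths V →₀ k

instance : AddCommGroup (PathCoalgebra k V) := inferInstanceAs (AddCommGroup (AllPaths V →₀ k))
instance : Module k (PathCoalgebra k V) := inferInstanceAs (Module k (AllPaths V →₀ k))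

/-- The basis of the path coalgebra that consists of the paths. -/
def pathBasis : Module.Basis (AllPaths V) k (PathCoalgebra k V) := ⟨LinearEquiv.refl k _⟩

variable {V}

/-- A path as an element of the path coalgebra. -/
def ofPath {x y : V} (p : Path x y) : PathCoalgebra k V := pathBasis k V (toAll p)

variable (V)

/-- `Δ(p) = ∑ r ⊗ q` over all cuts of `p` into `q` followed by `r`; `ε(p) = 1` if `p` has length
`0` and `ε(p) = 0` otherwise. -/
instance : CoalgebraStruct k (PathCoalgebra k V) where
  comul := (pathBasis k V).constr k fun p =>
    ((splits p.2.2).map fun d => ofPath k d.2.2 ⊗ₜ[k] ofPath k d.2.1).sum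
  counit := (pathBasis k V).constr k fun p => if p.2.2.length = 0 then 1 else 0

variable {V}

theorem comul_ofPath {x y : V} (p : Path x y) :
    Coalgebra.comul (R := k) (ofPath k p) =
      ((splits p).map fun d => ofPath k d.2.2 ⊗ₜ[k] ofPath k d.2.1).sum :=
  (pathBasis k V).constr_basis k _ _

theorem counit_ofPath {x y : V} (p : Path x y) :
    Coalgebra.counit (R := k) (ofPath k p) = if p.length = 0 then (1 : k) else 0 :=
  (pathBasis k V).constr_basis k _ _

/-- Only the trivial cut has a first piece of length zero. -/
theorem splits_sum_left {M : Type*} [AddCommMonoid M] {x y : V} (p : Path x y)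
    (f : ∀ m : V, Path m y → M) :
    ((splits p).map fun d => if d.2.1.length = 0 then f d.1 d.2.2 else 0).sum = f x p := by
  induction p with
  | nil => simp [splits]
  | cons p a ih => simpa [splits, Function.comp_def] using ih fun m r => f m (r.cons a)

/-- Only the trivial cut has a second piece of length zero. -/
theorem splits_sum_right {M : Type*} [AddCommMonoid M] {x y : V} (p : Path x y)
    (f : ∀ m : V, Path x m → M) :
    ((splits p).map fun d => if d.2.2.length = 0 then f d.1 d.2.1 else 0).sum = f y p := by
  cases p with
  | nil => simp [splits]
  | cons p a => simp [splits, Function.comp_def]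

theorem list_sum_tmul {M N ι : Type*} [AddCommGroup M] [Module k M] [AddCommGroup N] [Module k N]
    (l : List ι) (f : ι → M) (n : N) :
    (l.map f).sum ⊗ₜ[k] n = (l.map fun i => f i ⊗ₜ[k] n).sum := by
  induction l with
  | nil => simp
  | cons i l ih => simp [TensorProduct.add_tmul, ih]

theorem tmul_list_sum {M N ι : Type*} [AddCommGroup M] [Module k M] [AddCommGroup N] [Module k N]
    (l : List ι) (f : ι → M) (n : N) :
    n ⊗ₜ[k] (l.map f).sum = (l.map fun i => n ⊗ₜ[k] f i).sum := by
  induction l with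
  | nil => simp
  | cons i l ih => simp [TensorProduct.tmul_add, ih]

variable (V)

instance : Coalgebra k (PathCoalgebra k V) where
  coassoc := by
    refine (pathBasis k V).ext ?_
    rintro ⟨x, y, p⟩
    change TensorProduct.assoc k _ _ _ (LinearMap.rTensor _ _ (Coalgebra.comul (ofPath k p))) =
      LinearMap.lTensor _ _ (Coalgebra.comul (ofPath k p))
    simp only [comul_ofPath, map_list_sum, List.map_map, Function.comp_def,
      LinearMap.rTensor_tmul, LinearMap.lTensor_tmul]
    simp only [list_sum_tmul, tmul_list_sum, map_list_sum, List.map_map, Function.comp_def,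
      TensorProduct.assoc_tmul]
    exact splits_coassoc p fun m n q s r => ofPath k r ⊗ₜ[k] (ofPath k s ⊗ₜ[k] ofPath k q)
  rTensor_counit_comp_comul := by
    refine (pathBasis k V).ext ?_
    rintro ⟨x, y, p⟩
    change LinearMap.rTensor _ _ (Coalgebra.comul (ofPath k p)) = 1 ⊗ₜ[k] ofPath k p
    simp only [comul_ofPath, map_list_sum, List.map_map, Function.comp_def,
      LinearMap.rTensor_tmul, counit_ofPath, TensorProduct.ite_tmul]
    exact splits_sum_right p fun _ q => (1 : k) ⊗ₜ[k] ofPath k q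
  lTensor_counit_comp_comul := by
    refine (pathBasis k V).ext ?_
    rintro ⟨x, y, p⟩
    change LinearMap.lTensor _ _ (Coalgebra.comul (ofPath k p)) = ofPath k p ⊗ₜ[k] 1
    simp only [comul_ofPath, map_list_sum, List.map_map, Function.comp_def,
      LinearMap.lTensor_tmul, counit_ofPath, TensorProduct.tmul_ite]
    exact splits_sum_left p fun _ r => ofPath k r ⊗ₜ[k] (1 : k)

variable {V} {W : Type w} [Quiver.{w'} W]

theorem splits_mapPath (F : W ⥤q V) {x y : W} (p : Path x y) :
    splits (F.mapPath p) =
      (splits p).map fun d => ⟨F.obj d.1, F.mapPath d.2.1, F.mapPath d.2.2⟩ := by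
  induction p with
  | nil => simp [splits]
  | cons p a ih => simp [splits, ih, Function.comp_def]

theorem length_mapPath (F : W ⥤q V) {x y : W} (p : Path x y) :
    (F.mapPath p).length = p.length := by
  induction p with
  | nil => simp
  | cons p a ih => simp [ih]

/-- The action of a quiver morphism on bundled paths. -/
def mapAll (F : W ⥤q V) (P : AllPaths W) : AllPaths V := toAll (F.mapPath P.2.2)

/-- The coalgebra map `k Q' → k Q` induced by a quiver morphism `Q' → Q`. -/
def pathMap (F : W ⥤q V) : PathCoalgebra k W →ₗc[k] PathCoalgebra k V where
  toLinearMap := (pathBasis k W).constr k fun P => ofPath k (F.mapPath P.2.2)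
  counit_comp := by
    refine (pathBasis k W).ext ?_
    rintro ⟨x, y, p⟩
    rw [LinearMap.comp_apply, Module.Basis.constr_basis, counit_ofPath, length_mapPath]
    exact (counit_ofPath k p).symm
  map_comp_comul := by
    refine (pathBasis k W).ext ?_
    rintro ⟨x, y, p⟩
    rw [LinearMap.comp_apply, LinearMap.comp_apply, Module.Basis.constr_basis, comul_ofPath]
    change TensorProduct.map _ _ (Coalgebra.comul (ofPath k p)) = _
    rw [comul_ofPath]
    simp only [splits_mapPath, map_list_sum, List.map_map, Function.comp_def,
      TensorProduct.map_tmul]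
    simp only [ofPath, Module.Basis.constr_basis]

end PathCoalgebra

/-! ### Subcoalgebras, minimal elements -/

section Minimal

variable {k : Type z} [Field k] {V : Type u} [Quiver.{v} V]

/-- `B` is a subcoalgebra: `Δ(B)` lies in `B ⊗ B`. -/
def IsSubcoalgebra {C : Type*} [AddCommGroup C] [Module k C] [Coalgebra k C]
    (B : Submodule k C) : Prop :=
  ∀ b ∈ B, Coalgebra.comul (R := k) b ∈ LinearMap.range (TensorProduct.map B.subtype B.subtype)

/-- `B` is an admissible subcoalgebra of the path coalgebra: it contains all vertices and all
arrows. -/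
structure IsAdmissible (B : Submodule k (PathCoalgebra k V)) : Prop where
  isSubcoalgebra : IsSubcoalgebra B
  vertex_mem : ∀ x : V, ofPath k (Path.nil : Path x x) ∈ B
  arrow_mem : ∀ {x y : V} (a : x ⟶ y), ofPath k a.toPath ∈ B

/-- The paths that occur in `b`. -/
def supp (b : PathCoalgebra k V) : Finset (AllPaths V) := ((pathBasis k V).repr b).support

open Classical in
/-- The partial sum of `b = ∑ λ_p p` over the paths `p` in `S`. -/
def partialSum (S : Set (AllPaths V)) (b : PathCoalgebra k V) : PathCoalgebra k V :=
  ∑ p ∈ supp b with p ∈ S, (pathBasis k V).repr b p • pathBasis k V p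

/-- `B(x, y)`: the elements of `B` that are combinations of paths from `x` to `y`. -/
def homPart (B : Submodule k (PathCoalgebra k V)) (x y : V) : Submodule k (PathCoalgebra k V) :=
  B ⊓ Submodule.span k (Set.range fun p : Path x y => ofPath k p)

/-- `b` is a minimal element of `B`, lying in `B(x, y)`. -/
structure IsMinimal (B : Submodule k (PathCoalgebra k V)) (x y : V) (b : PathCoalgebra k V) :
    Prop where
  mem : b ∈ homPart B x y
  two_le : 2 ≤ (supp b).card
  partialSum_notMem : ∀ S : Finset (AllPaths V), S.Nonempty → S ⊂ supp b →
    partialSum (S : Set (AllPaths V)) b ∉ homPart B x y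

/-- The relation `p ∼ q`: the distinct paths `p` and `q` occur in a common minimal element. -/
def PathRel (B : Submodule k (PathCoalgebra k V)) {x y : V} (p q : Path x y) : Prop :=
  p ≠ q ∧ ∃ b, IsMinimal B x y b ∧ toAll p ∈ supp b ∧ toAll q ∈ supp b

end Minimal

/-! ### The fundamental group and `N(B, x₀)` -/

section FundamentalGroup

variable {k : Type z} [Field k] {V : Type u} [Quiver.{v} V]

/-- Homotopy classes of walks from `x` to `y`: the morphisms of the free groupoid on the quiver
(walks modulo cancellation of `a a⁻¹` and `a⁻¹ a`). They compose from left to right. -/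
abbrev WalkClass (x y : V) := (FreeGroupoid.of V).obj x ⟶ (FreeGroupoid.of V).obj y

/-- The fundamental group `π₁(Q, x)`; as in any `CategoryTheory.End`, in the product `g * h`
the walk `h` is run first. -/
abbrev Pi1 (V : Type u) [Quiver.{v} V] (x : V) := End ((FreeGroupoid.of V).obj x)

/-- The homotopy class of a path. -/
def pathClass {x y : V} (p : Path x y) : WalkClass x y :=
  composePath ((FreeGroupoid.of V).mapPath p)

/-- `N(B, x₀)`: the normal subgroup of `π₁(Q, x₀)` generated by the classes of the closed walks
"`w`, then `q`, then `p` backwards, then `w` backwards", where `p ∼ q` are paths from `x` to `y`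
and `w` is a walk from `x₀` to `x`. -/
def relSubgroup (B : Submodule k (PathCoalgebra k V)) (x₀ : V) : Subgroup (Pi1 V x₀) :=
  Subgroup.normalClosure {g | ∃ (x y : V) (p q : Path x y) (w : WalkClass x₀ x), PathRel B p q ∧
    g = End.of (w ≫ pathClass q ≫ Groupoid.inv (pathClass p) ≫ Groupoid.inv w)}

instance (B : Submodule k (PathCoalgebra k V)) (x₀ : V) : (relSubgroup B x₀).Normal :=
  Subgroup.normalClosure_normal

end FundamentalGroup

/-! ### Galois coverings -/

section Coverings

variable {k : Type z} [Field k] {V : Type u} [Quiver.{v} V] {W : Type w} [Quiver.{w'} W]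

/-- The quiver is nonempty and any two vertices are joined by a walk. -/
def IsConnectedQuiver (V : Type u) [Quiver.{v} V] : Prop :=
  Nonempty V ∧ ∀ x y : V, Nonempty (@Path (Symmetrify V) _ x y)

/-- A Galois covering of quivers: a surjective morphism of connected quivers that is bijective on
the arrows starting, and on the arrows ending, at each vertex, and for which `F_*(π₁(Q', x'))` is
normal in `π₁(Q, F x')`. (Surjectivity on arrows follows from surjectivity on vertices.) -/
structure IsGaloisCovering (F : W ⥤q V) : Prop where
  connected_source : IsConnectedQuiver W
  connected_target : IsConnectedQuiver V
  surjective : Function.Surjective F.obj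
  isCovering : F.IsCovering
  normal : ∀ x' : W,
    ((freeGroupoidFunctor F).mapEnd ((FreeGroupoid.of W).obj x')).range.Normal

theorem existsUnique_lift {F : W ⥤q V} (hF : F.IsCovering) {L : V → W}
    (hL : ∀ x, F.obj (L x) = x) (p : AllPaths V) :
    ∃! P : AllPaths W, P.1 = L p.1 ∧ mapAll F P = p := by
  obtain ⟨x, s⟩ := p
  obtain ⟨x', rfl⟩ : ∃ x', F.obj x' = x := ⟨_, hL x⟩
  have key : ∀ y' : W, F.obj y' = F.obj x' →
      ∃! P : AllPaths W, P.1 = y' ∧ mapAll F P = ⟨F.obj x', s⟩ := by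
    intro y' hy
    generalize F.obj x' = x at s hy
    subst hy
    obtain ⟨P, hP, hu⟩ := (hF.pathStar_bijective y').existsUnique s
    refine ⟨⟨y', P⟩, ⟨rfl, ?_⟩, ?_⟩
    · rw [← hP]
      rfl
    · rintro ⟨z, R⟩ ⟨rfl, hR⟩
      rw [hu R (eq_of_heq (Sigma.mk.inj hR).2)]
  exact key _ (hL _)

/-- The lifting `L(p)` of a path `p` along a covering: the unique path over `p` that starts at
`L(s(p))`. -/
def liftPath {F : W ⥤q V} (hF : F.IsCovering) {L : V → W} (hL : ∀ x, F.obj (L x) = x)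
    (p : AllPaths V) : AllPaths W :=
  (existsUnique_lift hF hL p).choose

/-- `L(∑ λ_p p) = ∑ λ_p L(p)`. -/
def liftElem {F : W ⥤q V} (hF : F.IsCovering) {L : V → W} (hL : ∀ x, F.obj (L x) = x) :
    PathCoalgebra k V →ₗ[k] PathCoalgebra k W :=
  (pathBasis k V).constr k fun p => pathBasis k W (liftPath hF hL p)

/-- The span of all `L(b)`, where `L` is a lifting and `b` is a minimal element of `B` or a path
that belongs to `B`. -/
def liftSpan {F : W ⥤q V} (hF : F.IsCovering) (B : Submodule k (PathCoalgebra k V)) :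
    Submodule k (PathCoalgebra k W) :=
  Submodule.span k {c | ∃ (L : V → W) (hL : ∀ x, F.obj (L x) = x) (b : PathCoalgebra k V),
    ((∃ x y, IsMinimal B x y b) ∨ (b ∈ B ∧ ∃ (x y : V) (p : Path x y), b = ofPath k p)) ∧
    c = liftElem hF hL b}

/-- The quiver morphism `F : Q' → Q` restricts to a Galois coalgebra covering `B' → B`: `F` is a
Galois covering of quivers, `B'` is the span of the liftings of the minimal elements and of the
paths of `B`, and each minimal element of `B` in `B(x, y)` lifts to a minimal element of `B'` from
any given vertex over `x`. -/
structure IsGaloisCoalgebraCovering (F : W ⥤q V) (B' : Submodule k (PathCoalgebra k W))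
    (B : Submodule k (PathCoalgebra k V)) : Prop extends IsGaloisCovering F where
  eq_liftSpan : B' = liftSpan isCovering B
  lift_minimal : ∀ (x y : V) (b : PathCoalgebra k V), IsMinimal B x y b →
    ∀ x' : W, F.obj x' = x → ∃ (y' : W) (b' : PathCoalgebra k W),
      IsMinimal B' x' y' b' ∧ pathMap k F b' = b

/-- `F : B' → B` is a Galois coalgebra covering through which each Galois coalgebra covering of
`B` (by a quiver with vertices in `Type s` and arrows in `Type t`) is factored by a Galois
coalgebra covering `E`. -/
def IsUniversalCovering.{s, t, u₁, v₁, u₂, v₂, u₃} {k : Type u₁} [Field k]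
    {V : Type u₂} [Quiver.{v₂} V] {W : Type u₃} [Quiver.{v₁} W]
    (F : W ⥤q V) (B' : Submodule k (PathCoalgebra k W))
    (B : Submodule k (PathCoalgebra k V)) : Prop :=
  IsGaloisCoalgebraCovering F B' B ∧
  ∀ (U : Type s) [Quiver.{t} U] (F₁ : U ⥤q V) (B₁ : Submodule k (PathCoalgebra k U)),
    IsGaloisCoalgebraCovering F₁ B₁ B →
      ∃ E : W ⥤q U, IsGaloisCoalgebraCovering E B' B₁ ∧ E ⋙q F₁ = F

/-- `θ` is a morphism from the coalgebra covering `F : B' → B` to `F₁ : B₁ → B`: a quiver morphism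
over `Q` whose induced coalgebra map takes `B'` into `B₁`. -/
structure IsCoveringMorphism {U : Type*} [Quiver U] (F : W ⥤q V)
    (B' : Submodule k (PathCoalgebra k W)) (F₁ : U ⥤q V) (B₁ : Submodule k (PathCoalgebra k U))
    (θ : W ⥤q U) : Prop where
  comp_eq : θ ⋙q F₁ = F
  map_mem : ∀ b ∈ B', pathMap k θ b ∈ B₁

/-- Isomorphism of coalgebra coverings of `B`: mutually inverse morphisms of coverings. -/
def CoveringsIsomorphic {U : Type*} [Quiver U] (F : W ⥤q V)
    (B' : Submodule k (PathCoalgebra k W)) (F₁ : U ⥤q V)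
    (B₁ : Submodule k (PathCoalgebra k U)) : Prop :=
  ∃ (θ : W ⥤q U) (η : U ⥤q W), IsCoveringMorphism F B' F₁ B₁ θ ∧ IsCoveringMorphism F₁ B₁ F B' η ∧
    θ ⋙q η = 𝟭q W ∧ η ⋙q θ = 𝟭q U

end Coverings

/-! ### Gradings and smash coproducts -/

section Smash

variable {V : Type u} [Quiver.{v} V] {G : Type w} [Group G]

/-- An arrow weighting with values in `G`. -/
abbrev ArrowWeighting (V : Type u) [Quiver.{v} V] (G : Type w) := ∀ ⦃x y : V⦄, (x ⟶ y) → G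

/-- The extension of an arrow weighting to paths: `δ(aₙ ⋯ a₁) = δ(aₙ) ⋯ δ(a₁)`, where `a₁` is the
first arrow of the path. -/
def pathWeight (δ : ArrowWeighting V G) {x : V} : {y : V} → Path x y → G
  | _, .nil => 1
  | _, .cons p a => δ a * pathWeight δ p

theorem pathWeight_comp (δ : ArrowWeighting V G) {x y : V} (p : Path x y) {t : V}
    (q : Path y t) : pathWeight δ (p.comp q) = pathWeight δ q * pathWeight δ p := by
  induction q with
  | nil => simp [pathWeight]
  | cons q a ih => simp [pathWeight, ih, mul_assoc]

/-- `B` is homogeneous for the grading of `k Q` in which the path `p` has degree `δ(p)`. -/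
def IsHomogeneousSub {k : Type z} [Field k] (δ : ArrowWeighting V G)
    (B : Submodule k (PathCoalgebra k V)) : Prop :=
  ∀ b ∈ B, ∀ g : G, partialSum {p : AllPaths V | pathWeight δ p.2.2 = g} b ∈ B

/-- The vertices `x ⋊ g` of the smash coproduct quiver `Q ⋊ G`. -/
@[ext] structure SmashQuiver (δ : ArrowWeighting V G) where
  /-- the vertex of the base -/
  vertex : V
  /-- the group component -/
  deg : G

/-- The arrows of `Q ⋊ G`: the arrow `a ⋊ g` goes from `s(a) ⋊ g` to `t(a) ⋊ δ(a) g`. -/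
instance (δ : ArrowWeighting V G) : Quiver.{v} (SmashQuiver δ) where
  Hom X Y := {a : X.vertex ⟶ Y.vertex // Y.deg = δ a * X.deg}

/-- The canonical map `Q ⋊ G → Q`. -/
def smashProj (δ : ArrowWeighting V G) : SmashQuiver δ ⥤q V where
  obj X := X.vertex
  map a := a.1

variable (k : Type z) [Field k]

/-- The smash coproduct coalgebra `k Q ⋊ k G`, with basis the elements `p ⋊ g`. -/
def SmashCoproduct (_δ : ArrowWeighting V G) : Type (max z u v w) := (AllPaths V × G) →₀ k

variable (δ : ArrowWeighting V G)

instance : AddCommGroup (SmashCoproduct k δ) :=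
  inferInstanceAs (AddCommGroup ((AllPaths V × G) →₀ k))
instance : Module k (SmashCoproduct k δ) :=
  inferInstanceAs (Module k ((AllPaths V × G) →₀ k))

/-- The basis of the elements `p ⋊ g`. -/
def smashBasis : Module.Basis (AllPaths V × G) k (SmashCoproduct k δ) := ⟨LinearEquiv.refl k _⟩

/-- The element `p ⋊ g`. -/
def smashPath {x y : V} (p : Path x y) (g : G) : SmashCoproduct k δ :=
  smashBasis k δ (toAll p, g)

/-- `Δ(p ⋊ g) = ∑ (r ⋊ δ(q) g) ⊗ (q ⋊ g)` over all cuts of `p` into `q` followed by `r`, and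
`ε(p ⋊ g) = ε(p)`. -/
instance : CoalgebraStruct k (SmashCoproduct k δ) where
  comul := (smashBasis k δ).constr k fun P =>
    ((splits P.1.2.2).map fun d =>
      smashPath k δ d.2.2 (pathWeight δ d.2.1 * P.2) ⊗ₜ[k] smashPath k δ d.2.1 P.2).sum
  counit := (smashBasis k δ).constr k fun P => if P.1.2.2.length = 0 then 1 else 0

theorem comul_smashPath {x y : V} (p : Path x y) (g : G) :
    Coalgebra.comul (R := k) (smashPath k δ p g) =
      ((splits p).map fun d =>
        smashPath k δ d.2.2 (pathWeight δ d.2.1 * g) ⊗ₜ[k] smashPath k δ d.2.1 g).sum :=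
  (smashBasis k δ).constr_basis k _ _

theorem counit_smashPath {x y : V} (p : Path x y) (g : G) :
    Coalgebra.counit (R := k) (smashPath k δ p g) = if p.length = 0 then (1 : k) else 0 :=
  (smashBasis k δ).constr_basis k _ _

instance : Coalgebra k (SmashCoproduct k δ) where
  coassoc := by
    refine (smashBasis k δ).ext ?_
    rintro ⟨⟨x, y, p⟩, g⟩
    change TensorProduct.assoc k _ _ _ (LinearMap.rTensor _ _ (Coalgebra.comul
      (smashPath k δ p g))) = LinearMap.lTensor _ _ (Coalgebra.comul (smashPath k δ p g))
    simp only [comul_smashPath, map_list_sum, List.map_map, Function.comp_def,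
      LinearMap.rTensor_tmul, LinearMap.lTensor_tmul]
    simp only [list_sum_tmul, tmul_list_sum, map_list_sum, List.map_map, Function.comp_def,
      TensorProduct.assoc_tmul]
    refine (splits_coassoc p fun m n q s r =>
      smashPath k δ r (pathWeight δ s * (pathWeight δ q * g)) ⊗ₜ[k]
        (smashPath k δ s (pathWeight δ q * g) ⊗ₜ[k] smashPath k δ q g)).trans ?_
    refine congrArg List.sum (List.map_congr_left fun d _ => ?_)
    refine congrArg List.sum (List.map_congr_left fun e he => ?_)
    rw [← (mem_splits _ _).1 he, pathWeight_comp, mul_assoc]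
  rTensor_counit_comp_comul := by
    refine (smashBasis k δ).ext ?_
    rintro ⟨⟨x, y, p⟩, g⟩
    change LinearMap.rTensor _ _ (Coalgebra.comul (smashPath k δ p g)) = 1 ⊗ₜ[k] smashPath k δ p g
    simp only [comul_smashPath, map_list_sum, List.map_map, Function.comp_def,
      LinearMap.rTensor_tmul, counit_smashPath, TensorProduct.ite_tmul]
    exact splits_sum_right p fun _ q => (1 : k) ⊗ₜ[k] smashPath k δ q g
  lTensor_counit_comp_comul := by
    refine (smashBasis k δ).ext ?_
    rintro ⟨⟨x, y, p⟩, g⟩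
    change LinearMap.lTensor _ _ (Coalgebra.comul (smashPath k δ p g)) = smashPath k δ p g ⊗ₜ[k] 1
    simp only [comul_smashPath, map_list_sum, List.map_map, Function.comp_def,
      LinearMap.lTensor_tmul, counit_smashPath, TensorProduct.tmul_ite]
    refine Eq.trans ?_ ((splits_sum_left p fun _ r => smashPath k δ r g ⊗ₜ[k] (1 : k)))
    refine congrArg List.sum (List.map_congr_left fun d _ => ?_)
    obtain ⟨m, q, r⟩ := d
    cases q <;> simp [pathWeight]

theorem smashQuiver_deg {X Y : SmashQuiver δ} (P : Path X Y) :
    pathWeight δ ((smashProj δ).mapPath P) * X.deg = Y.deg := by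
  induction P with
  | nil => simp [pathWeight]
  | cons P a ih =>
    refine Eq.trans ?_ (a.2.trans (congrArg _ ih.symm)).symm
    rw [← mul_assoc]
    rfl

theorem smashProj_star_bijective (X : SmashQuiver δ) :
    Function.Bijective ((smashProj δ).star X) := by
  constructor
  · rintro ⟨⟨y, h⟩, a, ha⟩ ⟨⟨y', h'⟩, a', ha'⟩ e
    obtain ⟨e1, e2⟩ := Sigma.mk.inj e
    change y = y' at e1
    subst e1
    obtain rfl : a = a' := eq_of_heq e2
    have hh : h = h' := ha.trans ha'.symm
    subst hh
    rfl
  · rintro ⟨y, a⟩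
    exact ⟨⟨⟨y, δ a * X.deg⟩, ⟨a, rfl⟩⟩, rfl⟩

theorem smash_index_bijective : Function.Bijective
    fun P : AllPaths (SmashQuiver δ) => (mapAll (smashProj δ) P, P.1.deg) := by
  constructor
  · rintro ⟨⟨x, g⟩, P⟩ ⟨⟨x', g'⟩, P'⟩ e
    simp only [mapAll, Prod.mk.injEq, Sigma.mk.injEq] at e
    obtain ⟨⟨h1, h2⟩, rfl⟩ := e
    obtain rfl : x = x' := h1
    have := ((smashProj δ).pathStar_bijective (smashProj_star_bijective δ) ⟨x, g⟩).1
      (a₁ := P) (a₂ := P') (eq_of_heq h2)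
    rw [this]
  · rintro ⟨⟨x, s⟩, g⟩
    obtain ⟨P, hP⟩ :=
      ((smashProj δ).pathStar_bijective (smashProj_star_bijective δ) ⟨x, g⟩).2 s
    refine ⟨⟨⟨x, g⟩, P⟩, ?_⟩
    rw [← hP]
    rfl

/-- The coalgebra map `k(Q ⋊ G) → k Q ⋊ k G` that sends a path `P` of `Q ⋊ G` starting at `x ⋊ g`
to `F(P) ⋊ g`, where `F : Q ⋊ G → Q` is the canonical map. -/
def smashHom : PathCoalgebra k (SmashQuiver δ) →ₗc[k] SmashCoproduct k δ where
  toLinearMap := (pathBasis k (SmashQuiver δ)).constr k fun P =>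
    smashPath k δ ((smashProj δ).mapPath P.2.2) P.1.deg
  counit_comp := by
    refine (pathBasis k _).ext ?_
    rintro ⟨X, Y, P⟩
    rw [LinearMap.comp_apply, Module.Basis.constr_basis, counit_smashPath, length_mapPath]
    exact (counit_ofPath k P).symm
  map_comp_comul := by
    refine (pathBasis k _).ext ?_
    rintro ⟨X, Y, P⟩
    rw [LinearMap.comp_apply, LinearMap.comp_apply, Module.Basis.constr_basis, comul_smashPath]
    change TensorProduct.map _ _ (Coalgebra.comul (ofPath k P)) = _
    rw [comul_ofPath]
    simp only [splits_mapPath, map_list_sum, List.map_map, Function.comp_def,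
      TensorProduct.map_tmul]
    simp only [ofPath, Module.Basis.constr_basis, smashQuiver_deg]

theorem smashHom_bijective : Function.Bijective (smashHom k δ) := by
  have h : (smashHom k δ : PathCoalgebra k (SmashQuiver δ) →ₗ[k] SmashCoproduct k δ) =
      ((pathBasis k (SmashQuiver δ)).equiv (smashBasis k δ)
        (Equiv.ofBijective _ (smash_index_bijective δ))).toLinearMap := by
    refine (pathBasis k _).ext fun P => ?_
    rw [LinearEquiv.coe_coe, Module.Basis.equiv_apply]
    exact (pathBasis k _).constr_basis k _ _
  have h' : ⇑(smashHom k δ) = ⇑((pathBasis k (SmashQuiver δ)).equiv (smashBasis k δ)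
        (Equiv.ofBijective _ (smash_index_bijective δ))) :=
    funext fun c => LinearMap.congr_fun h c
  rw [h']
  exact LinearEquiv.bijective _

/-- The identification `k(Q ⋊ G) ≅ k Q ⋊ k G` of coalgebras. -/
def smashIso : PathCoalgebra k (SmashQuiver δ) ≃ₗc[k] SmashCoproduct k δ :=
  CoalgEquiv.ofBijective (f := smashHom k δ) (smashHom_bijective k δ)

variable {k}

/-- The element `b ⋊ g` for `b` in the path coalgebra. -/
def smashElem (g : G) : PathCoalgebra k V →ₗ[k] SmashCoproduct k δ :=
  (pathBasis k V).constr k fun p => smashPath k δ p.2.2 g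

/-- `B ⋊ k G` inside `k Q ⋊ k G`: the span of all `b ⋊ g` with `b` in `B`. -/
def smashSub (B : Submodule k (PathCoalgebra k V)) : Submodule k (SmashCoproduct k δ) :=
  ⨆ g : G, B.map (smashElem δ g)

/-- `B ⋊ k G` as a subspace of the path coalgebra of `Q ⋊ G`. -/
def smashCover (B : Submodule k (PathCoalgebra k V)) :
    Submodule k (PathCoalgebra k (SmashQuiver δ)) :=
  (smashSub δ B).comap (smashIso k δ).toLinearEquiv.toLinearMap

end Smash

section Universal

variable {k : Type z} [Field k] {V : Type u} [Quiver.{v} V]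

/-- The weighting `Q₁ → π₁(Q, x₀) → π₁(Q, x₀) / N(B, x₀)` that belongs to a choice of a walk class
`c x` from `x₀` to each vertex `x` (equivalently, to a lifting of the vertices of `Q` to the
universal covering quiver): the arrow `a : x → y` gets the class of
"`c x`, then `a`, then `c y` backwards". -/
def universalWeighting (B : Submodule k (PathCoalgebra k V)) (x₀ : V)
    (c : ∀ x : V, WalkClass x₀ x) : ArrowWeighting V (Pi1 V x₀ ⧸ relSubgroup B x₀) :=
  fun x y a => QuotientGroup.mk
    (End.of (c x ≫ (FreeGroupoid.of V).map a ≫ Groupoid.inv (c y)))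

/-- The quiver `Q ⋊ (π₁(Q, x₀) / N(B, x₀))`. -/
abbrev UniversalQuiver (B : Submodule k (PathCoalgebra k V)) (x₀ : V)
    (c : ∀ x : V, WalkClass x₀ x) : Type (max u v) :=
  SmashQuiver (universalWeighting B x₀ c)

/-- The canonical map `Q ⋊ (π₁(Q, x₀) / N(B, x₀)) → Q`. -/
abbrev universalProj (B : Submodule k (PathCoalgebra k V)) (x₀ : V)
    (c : ∀ x : V, WalkClass x₀ x) : UniversalQuiver B x₀ c ⥤q V :=
  smashProj (universalWeighting B x₀ c)

/-- The smash coproduct `B ⋊ (π₁(Q, x₀) / N(B, x₀))`, inside the path coalgebra of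
`Q ⋊ (π₁(Q, x₀) / N(B, x₀))`. -/
abbrev universalCover (B : Submodule k (PathCoalgebra k V)) (x₀ : V)
    (c : ∀ x : V, WalkClass x₀ x) : Submodule k (PathCoalgebra k (UniversalQuiver B x₀ c)) :=
  smashCover (universalWeighting B x₀ c) B

end Universal

end PathCoalg

end

open PathCoalg

/-!
A subcoalgebra `B` is the sum of its parts `B(x, y)`, and each of these is spanned by minimal
elements and paths. Since a covering `F` is injective on paths with a fixed source, a combination
of such paths is in the span of the lifts of `B` exactly when its image under `F` is in `B`. The
universal weighting is constant on the support of a minimal element, so `B` is graded by it and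
the smash coproduct is a Galois coalgebra covering.

In any Galois coalgebra covering `F' : B' → B` minimal elements lift to minimal elements, so two
paths of `Q` related by `∼` have lifts with the same end from each vertex of the fibre. Hence
`N(B, x₀)` acts trivially on the fibres of `F'`. The closed walks of `Q` that lift to closed walks
of `Q ⋊ G` are those of weight one, which are conjugate to elements of `N(B, x₀)`, and the lifting
criterion for coverings gives the factorization `E : Q ⋊ G → Q'`.
-/

noncomputable section

namespace PathCoalg

section PartialSums

variable {k : Type z} [Field k] {V : Type u} [Quiver.{v} V]

theorem linearMap_ext_ofPath {M : Type*} [AddCommGroup M] [Module k M]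
    {f g : PathCoalgebra k V →ₗ[k] M}
    (h : ∀ (x y : V) (p : Path x y), f (ofPath k p) = g (ofPath k p)) : f = g :=
  (pathBasis k V).ext fun P => h P.1 P.2.1 P.2.2

theorem repr_ofPath {x y : V} (p : Path x y) :
    (pathBasis k V).repr (ofPath k p) = Finsupp.single (toAll p) 1 :=
  (pathBasis k V).repr_self _

theorem mem_supp {b : PathCoalgebra k V} {P : AllPaths V} :
    P ∈ supp b ↔ (pathBasis k V).repr b P ≠ 0 :=
  Finsupp.mem_support_iff

theorem supp_ofPath {x y : V} (p : Path x y) : supp (ofPath k p) = {toAll p} := by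
  rw [supp, repr_ofPath, Finsupp.support_single _ one_ne_zero]

open Classical in
theorem repr_partialSum (S : Set (AllPaths V)) (b : PathCoalgebra k V) :
    (pathBasis k V).repr (partialSum S b) = ((pathBasis k V).repr b).filter (· ∈ S) := by
  simp [partialSum, supp, Finsupp.filter_eq_sum]

/-- The projection of the path coalgebra onto the span of the paths in `S`: `partialSum S` as a
linear map. -/
def partialSumHom (S : Set (AllPaths V)) : PathCoalgebra k V →ₗ[k] PathCoalgebra k V where
  toFun := partialSum S
  map_add' b c := (pathBasis k V).repr.injective <| by
    simp only [repr_partialSum, map_add, Finsupp.filter_add]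
  map_smul' r b := (pathBasis k V).repr.injective <| by
    simp only [repr_partialSum, map_smul, Finsupp.filter_smul, RingHom.id_apply]

theorem mem_supp_partialSum {S : Set (AllPaths V)} {b : PathCoalgebra k V} {P : AllPaths V} :
    P ∈ supp (partialSum S b) ↔ P ∈ supp b ∧ P ∈ S := by
  classical
  rw [supp, repr_partialSum, Finsupp.support_filter, Finset.mem_filter, supp]

theorem partialSum_add_compl (S : Set (AllPaths V)) (b : PathCoalgebra k V) :
    partialSum S b + partialSum Sᶜ b = b := by
  classical
  apply (pathBasis k V).repr.injective
  ext P
  simp [repr_partialSum]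

theorem partialSum_congr {S T : Set (AllPaths V)} {b : PathCoalgebra k V}
    (h : ∀ P ∈ supp b, (P ∈ S ↔ P ∈ T)) : partialSum S b = partialSum T b := by
  classical
  apply (pathBasis k V).repr.injective
  ext P
  by_cases hP : P ∈ supp b
  · simp [repr_partialSum, Finsupp.filter_apply, h P hP]
  · simp [repr_partialSum, Finsupp.filter_apply, not_not.1 (mt mem_supp.2 hP)]

theorem partialSum_eq_self_iff {S : Set (AllPaths V)} {b : PathCoalgebra k V} :
    partialSum S b = b ↔ ∀ P ∈ supp b, P ∈ S := by
  classical
  rw [← (pathBasis k V).repr.injective.eq_iff, repr_partialSum, Finsupp.filter_eq_self_iff]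
  exact forall_congr' fun P => imp_congr_left mem_supp.symm

theorem partialSum_eq_zero_iff {S : Set (AllPaths V)} {b : PathCoalgebra k V} :
    partialSum S b = 0 ↔ ∀ P ∈ supp b, P ∉ S := by
  classical
  rw [← (pathBasis k V).repr.map_eq_zero_iff, repr_partialSum, Finsupp.filter_eq_zero_iff]
  exact forall_congr' fun P => by rw [mem_supp, not_imp_not]

theorem card_supp_partialSum_lt {S : Set (AllPaths V)} {b : PathCoalgebra k V}
    (h : partialSum S b ≠ b) : (supp (partialSum S b)).card < (supp b).card := by
  obtain ⟨P, hP, hPS⟩ : ∃ P ∈ supp b, P ∉ S := by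
    by_contra! hall
    exact h (partialSum_eq_self_iff.2 hall)
  exact Finset.card_lt_card <|
    (Finset.ssubset_iff_of_subset fun _ hR => (mem_supp_partialSum.1 hR).1).2
      ⟨P, hP, fun hP' => hPS (mem_supp_partialSum.1 hP').2⟩

theorem partialSum_ofPath (S : Set (AllPaths V)) {x y : V} (p : Path x y)
    [Decidable (toAll p ∈ S)] :
    partialSum S (ofPath k p) = if toAll p ∈ S then ofPath k p else 0 := by
  split_ifs with h
  · exact partialSum_eq_self_iff.2 (by simpa [supp_ofPath] using h)
  · exact partialSum_eq_zero_iff.2 (by simpa [supp_ofPath] using h)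

theorem sum_partialSum_fiber {ι : Type*} (f : AllPaths V → ι) (b : PathCoalgebra k V)
    (T : Finset ι) (hT : ∀ P ∈ supp b, f P ∈ T) :
    ∑ i ∈ T, partialSum {P | f P = i} b = b := by
  classical
  apply (pathBasis k V).repr.injective
  ext P
  simp only [map_sum, Finsupp.coe_finsetSum, Finset.sum_apply, repr_partialSum,
    Finsupp.filter_apply, Set.mem_ofPred_eq, Finset.sum_ite_eq, ite_eq_left_iff]
  exact fun hP => (not_not.1 (mt (hT P) hP ∘ mem_supp.2)).symm

end PartialSums

section HomParts

variable {k : Type z} [Field k] {V : Type u} [Quiver.{v} V] {B : Submodule k (PathCoalgebra k V)}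
  {x y : V} {b : PathCoalgebra k V}

theorem mem_span_ofPath_iff :
    b ∈ Submodule.span k (Set.range fun p : Path x y => ofPath k p) ↔
      ∀ P ∈ supp b, P.1 = x ∧ P.2.1 = y := by
  have hrange : (Set.range fun p : Path x y => ofPath k p) =
      pathBasis k V '' {P | P.1 = x ∧ P.2.1 = y} := by
    ext c
    constructor
    · rintro ⟨p, rfl⟩
      exact ⟨toAll p, ⟨rfl, rfl⟩, rfl⟩
    · rintro ⟨⟨_, _, p⟩, ⟨rfl, rfl⟩, rfl⟩
      exact ⟨p, rfl⟩
  rw [hrange, Module.Basis.mem_span_image]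
  rfl

theorem mem_homPart_iff :
    b ∈ homPart B x y ↔ b ∈ B ∧ ∀ P ∈ supp b, P.1 = x ∧ P.2.1 = y := by
  rw [homPart, Submodule.mem_inf, mem_span_ofPath_iff]

theorem ofPath_mem_homPart (p : Path x y) (hp : ofPath k p ∈ B) : ofPath k p ∈ homPart B x y :=
  ⟨hp, Submodule.subset_span ⟨p, rfl⟩⟩

theorem partialSum_mem_homPart_iff (hb : b ∈ homPart B x y) {S : Set (AllPaths V)} :
    partialSum S b ∈ homPart B x y ↔ partialSum S b ∈ B := by
  refine ⟨fun h => h.1, fun h => mem_homPart_iff.2 ⟨h, fun P hP => ?_⟩⟩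
  exact (mem_homPart_iff.1 hb).2 P (mem_supp_partialSum.1 hP).1

theorem isMinimal_iff :
    IsMinimal B x y b ↔ b ∈ homPart B x y ∧ 2 ≤ (supp b).card ∧
      ∀ S : Set (AllPaths V), partialSum S b ∈ B → partialSum S b = 0 ∨ partialSum S b = b := by
  constructor
  · refine fun h => ⟨h.mem, h.two_le, fun S hS => ?_⟩
    by_contra! hne
    have hsupp : partialSum (supp (partialSum S b) : Set (AllPaths V)) b = partialSum S b :=
      partialSum_congr fun P hP => mem_supp_partialSum.trans (and_iff_right hP)
    refine h.partialSum_notMem (supp (partialSum S b)) ?_ ?_ ?_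
    · exact Finsupp.support_nonempty_iff.2 ((pathBasis k V).repr.map_ne_zero_iff.2 hne.1)
    · refine ⟨fun P hP => (mem_supp_partialSum.1 hP).1, fun hsub => hne.2 ?_⟩
      exact partialSum_eq_self_iff.2 fun P hP => (mem_supp_partialSum.1 (hsub hP)).2
    · rw [hsupp]
      exact (partialSum_mem_homPart_iff h.mem).2 hS
  · rintro ⟨hb, h2, h⟩
    refine ⟨hb, h2, fun S hne hSb hS => ?_⟩
    rcases h S hS.1 with h0 | hself
    · obtain ⟨P, hP⟩ := hne
      exact partialSum_eq_zero_iff.1 h0 P (hSb.1 hP) hP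
    · exact hSb.2 (partialSum_eq_self_iff.1 hself)

/-- The minimal elements of `B` together with the paths that belong to `B`: the generators of `B`
whose liftings span the total space of a Galois coalgebra covering. -/
def minimalOrPath (B : Submodule k (PathCoalgebra k V)) : Set (PathCoalgebra k V) :=
  {b | (∃ x y, IsMinimal B x y b) ∨ (b ∈ B ∧ ∃ (x y : V) (p : Path x y), b = ofPath k p)}

theorem minimalOrPath_subset (B : Submodule k (PathCoalgebra k V)) : minimalOrPath B ⊆ B := by
  rintro b (⟨x, y, hb⟩ | hb)
  exacts [(mem_homPart_iff.1 hb.mem).1, hb.1]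

theorem mem_span_minimalOrPath_of_card_supp_le_one (hb : b ∈ B) (h : (supp b).card ≤ 1) :
    b ∈ Submodule.span k (minimalOrPath B) := by
  rcases eq_or_ne b 0 with rfl | hb0
  · exact Submodule.zero_mem _
  have hcard : (supp b).card = 1 := le_antisymm h <| Finset.card_pos.2 <|
    Finsupp.support_nonempty_iff.2 ((pathBasis k V).repr.map_ne_zero_iff.2 hb0)
  obtain ⟨P, r, hr0, hr⟩ := Finsupp.card_support_eq_one'.1 hcard
  obtain rfl : b = r • ofPath k P.2.2 := (pathBasis k V).repr.injective <| by
    rw [hr, map_smul, repr_ofPath, Finsupp.smul_single_one]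
  have hP : ofPath k P.2.2 ∈ B := (B.smul_mem_iff hr0).1 hb
  exact Submodule.smul_mem _ _ (Submodule.subset_span (Or.inr ⟨hP, _, _, P.2.2, rfl⟩))

theorem exists_add_eq_of_not_isMinimal (hb : b ∈ homPart B x y) (h2 : 2 ≤ (supp b).card)
    (hmin : ¬IsMinimal B x y b) :
    ∃ b₁ ∈ homPart B x y, ∃ b₂ ∈ homPart B x y, b₁ + b₂ = b ∧
      (supp b₁).card < (supp b).card ∧ (supp b₂).card < (supp b).card := by
  obtain ⟨S, hS, h0, hne⟩ : ∃ S : Set (AllPaths V),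
      partialSum S b ∈ B ∧ partialSum S b ≠ 0 ∧ partialSum S b ≠ b := by
    by_contra! hcon
    exact hmin (isMinimal_iff.2 ⟨hb, h2, fun S hS => or_iff_not_imp_left.2 (hcon S hS)⟩)
  have hadd : partialSum S b + partialSum Sᶜ b = b := partialSum_add_compl S b
  have hS' : partialSum S b ∈ homPart B x y := (partialSum_mem_homPart_iff hb).2 hS
  refine ⟨_, hS', _, (Submodule.add_mem_iff_right _ hS').1 (hadd.symm ▸ hb), hadd,
    card_supp_partialSum_lt hne, card_supp_partialSum_lt fun hc => h0 ?_⟩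
  rwa [hc, add_eq_right] at hadd

theorem homPart_le_span_minimalOrPath (B : Submodule k (PathCoalgebra k V)) (x y : V) :
    homPart B x y ≤ Submodule.span k (minimalOrPath B) := by
  intro b hb
  induction hn : (supp b).card using Nat.strong_induction_on generalizing b with
  | _ n ih =>
    subst hn
    by_cases hmin : IsMinimal B x y b
    · exact Submodule.subset_span (Or.inl ⟨x, y, hmin⟩)
    rcases Nat.lt_or_ge (supp b).card 2 with h | h
    · exact mem_span_minimalOrPath_of_card_supp_le_one hb.1 (Nat.le_of_lt_succ h)
    · obtain ⟨b₁, hb₁, b₂, hb₂, rfl, hlt₁, hlt₂⟩ := exists_add_eq_of_not_isMinimal hb h hmin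
      exact Submodule.add_mem _ (ih _ hlt₁ hb₁ rfl) (ih _ hlt₂ hb₂ rfl)

/-- `B` is the sum of its parts `B(x, y)`. The total space of a Galois coalgebra covering of a
subcoalgebra has this property, and it is all of the coalgebra structure that liftings depend
on. -/
def IsSumOfHomParts (B : Submodule k (PathCoalgebra k V)) : Prop :=
  B ≤ ⨆ (x : V) (y : V), homPart B x y

theorem IsSumOfHomParts.span_minimalOrPath (hB : IsSumOfHomParts B) :
    Submodule.span k (minimalOrPath B) = B :=
  le_antisymm (Submodule.span_le.2 (minimalOrPath_subset B))
    (hB.trans (iSup₂_le fun x y => homPart_le_span_minimalOrPath B x y))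

end HomParts

section Subcoalgebras

variable {k : Type z} [Field k]

section General

variable {C : Type*} [AddCommGroup C] [Module k C] [Coalgebra k C] {B : Submodule k C}

theorem IsSubcoalgebra.rid_lTensor_comul_mem (hB : IsSubcoalgebra B) (φ : C →ₗ[k] k) {b : C}
    (hb : b ∈ B) : TensorProduct.rid k C (φ.lTensor C (Coalgebra.comul b)) ∈ B := by
  obtain ⟨t, ht⟩ := hB b hb
  have hcomp : ((TensorProduct.rid k C).toLinearMap ∘ₗ φ.lTensor C) ∘ₗ
      TensorProduct.map B.subtype B.subtype =
        B.subtype ∘ₗ (TensorProduct.rid k B).toLinearMap ∘ₗ (φ ∘ₗ B.subtype).lTensor B :=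
    TensorProduct.ext' fun _ _ => by simp
  rw [← ht]
  exact (LinearMap.congr_fun hcomp t).symm ▸ Subtype.property _

theorem IsSubcoalgebra.lid_rTensor_comul_mem (hB : IsSubcoalgebra B) (φ : C →ₗ[k] k) {b : C}
    (hb : b ∈ B) : TensorProduct.lid k C (φ.rTensor C (Coalgebra.comul b)) ∈ B := by
  obtain ⟨t, ht⟩ := hB b hb
  have hcomp : ((TensorProduct.lid k C).toLinearMap ∘ₗ φ.rTensor C) ∘ₗ
      TensorProduct.map B.subtype B.subtype =
        B.subtype ∘ₗ (TensorProduct.lid k B).toLinearMap ∘ₗ (φ ∘ₗ B.subtype).rTensor B :=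
    TensorProduct.ext' fun _ _ => by simp
  rw [← ht]
  exact (LinearMap.congr_fun hcomp t).symm ▸ Subtype.property _

theorem IsSubcoalgebra.map {D : Type*} [AddCommGroup D] [Module k D] [Coalgebra k D]
    (hB : IsSubcoalgebra B) (f : C →ₗc[k] D) : IsSubcoalgebra (B.map f.toLinearMap) := by
  rintro _ ⟨b, hb, rfl⟩
  obtain ⟨t, ht⟩ := hB b hb
  have hcomp : TensorProduct.map (B.map f.toLinearMap).subtype (B.map f.toLinearMap).subtype ∘ₗ
      TensorProduct.map (f.toLinearMap.submoduleMap B) (f.toLinearMap.submoduleMap B) =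
        TensorProduct.map f.toLinearMap f.toLinearMap ∘ₗ
          TensorProduct.map B.subtype B.subtype :=
    TensorProduct.ext' fun _ _ => rfl
  refine ⟨TensorProduct.map (f.toLinearMap.submoduleMap B) (f.toLinearMap.submoduleMap B) t, ?_⟩
  calc _ = TensorProduct.map f.toLinearMap f.toLinearMap (Coalgebra.comul b) := by
        rw [← ht]
        exact LinearMap.congr_fun hcomp t
    _ = Coalgebra.comul (f b) := CoalgHomClass.map_comp_comul_apply f b

end General

variable {V : Type u} [Quiver.{v} V] {B : Submodule k (PathCoalgebra k V)}

/-- The functional on the path coalgebra that is dual to the vertex `x`. Contracting one side of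
the comultiplication with it selects the paths that start, or end, at `x`. -/
def vertexCoord (x : V) : PathCoalgebra k V →ₗ[k] k :=
  (pathBasis k V).coord (toAll (Path.nil : Path x x))

open Classical in
theorem vertexCoord_ofPath (x : V) {y t : V} (p : Path y t) :
    vertexCoord x (ofPath k p) = if p.length = 0 then if y = x then 1 else 0 else 0 := by
  rw [vertexCoord, Module.Basis.coord_apply, repr_ofPath, Finsupp.single_apply, ← ite_and]
  refine if_congr ⟨?_, ?_⟩ rfl rfl
  · intro h
    cases h
    exact ⟨rfl, rfl⟩
  · rintro ⟨h, rfl⟩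
    obtain rfl := Path.eq_of_length_zero p h
    rw [Path.eq_nil_of_length_zero p h]

theorem rid_lTensor_vertexCoord_comul (x : V) (b : PathCoalgebra k V) :
    TensorProduct.rid k _ ((vertexCoord x).lTensor _ (Coalgebra.comul (R := k) b)) =
      partialSum {P | P.1 = x} b := by
  classical
  suffices ((TensorProduct.rid k _).toLinearMap ∘ₗ (vertexCoord x).lTensor _) ∘ₗ
      Coalgebra.comul = partialSumHom {P | P.1 = x} from LinearMap.congr_fun this b
  refine linearMap_ext_ofPath fun s t p => ?_
  change TensorProduct.rid k _ ((vertexCoord x).lTensor _ (Coalgebra.comul (ofPath k p))) =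
    partialSum _ (ofPath k p)
  simp only [comul_ofPath, map_list_sum, List.map_map, Function.comp_def,
    LinearMap.lTensor_tmul, TensorProduct.rid_tmul, vertexCoord_ofPath, partialSum_ofPath,
    Set.mem_ofPred_eq, ite_smul, one_smul, zero_smul]
  exact splits_sum_left p fun m r => if s = x then ofPath k r else 0

theorem lid_rTensor_vertexCoord_comul (y : V) (b : PathCoalgebra k V) :
    TensorProduct.lid k _ ((vertexCoord y).rTensor _ (Coalgebra.comul (R := k) b)) =
      partialSum {P | P.2.1 = y} b := by
  classical
  suffices ((TensorProduct.lid k _).toLinearMap ∘ₗ (vertexCoord y).rTensor _) ∘ₗ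
      Coalgebra.comul = partialSumHom {P | P.2.1 = y} from LinearMap.congr_fun this b
  refine linearMap_ext_ofPath fun s t p => ?_
  change TensorProduct.lid k _ ((vertexCoord y).rTensor _ (Coalgebra.comul (ofPath k p))) =
    partialSum _ (ofPath k p)
  simp only [comul_ofPath, map_list_sum, List.map_map, Function.comp_def,
    LinearMap.rTensor_tmul, TensorProduct.lid_tmul, vertexCoord_ofPath, partialSum_ofPath,
    Set.mem_ofPred_eq, ite_smul, one_smul, zero_smul]
  exact splits_sum_right p fun m q => if m = y then ofPath k q else 0

theorem IsSubcoalgebra.partialSum_source_mem (hB : IsSubcoalgebra B) (x : V)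
    {b : PathCoalgebra k V} (hb : b ∈ B) : partialSum {P | P.1 = x} b ∈ B :=
  rid_lTensor_vertexCoord_comul x b ▸ hB.rid_lTensor_comul_mem (vertexCoord x) hb

theorem IsSubcoalgebra.partialSum_target_mem (hB : IsSubcoalgebra B) (y : V)
    {b : PathCoalgebra k V} (hb : b ∈ B) : partialSum {P | P.2.1 = y} b ∈ B :=
  lid_rTensor_vertexCoord_comul y b ▸ hB.lid_rTensor_comul_mem (vertexCoord y) hb

theorem IsSubcoalgebra.partialSum_source_target_mem_homPart (hB : IsSubcoalgebra B) (x y : V)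
    {b : PathCoalgebra k V} (hb : b ∈ B) :
    partialSum {P | P.2.1 = y} (partialSum {P | P.1 = x} b) ∈ homPart B x y := by
  refine mem_homPart_iff.2
    ⟨hB.partialSum_target_mem y (hB.partialSum_source_mem x hb), fun P hP => ?_⟩
  obtain ⟨hP, hy⟩ := mem_supp_partialSum.1 hP
  exact ⟨(mem_supp_partialSum.1 hP).2, hy⟩

theorem IsSubcoalgebra.isSumOfHomParts (hB : IsSubcoalgebra B) : IsSumOfHomParts B := by
  classical
  intro b hb
  rw [← sum_partialSum_fiber (fun P => P.1) b _ fun P hP => Finset.mem_image_of_mem _ hP]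
  refine Submodule.sum_mem _ fun x _ => ?_
  rw [← sum_partialSum_fiber (fun P => P.2.1) (partialSum _ b) _
    fun P hP => Finset.mem_image_of_mem _ hP]
  exact Submodule.sum_mem _ fun y _ => Submodule.mem_iSup_of_mem x <|
    Submodule.mem_iSup_of_mem y <| hB.partialSum_source_target_mem_homPart x y hb

end Subcoalgebras

section PathMap

variable {k : Type z} [Field k] {V : Type u} [Quiver.{v} V] {W : Type w} [Quiver.{w'} W]

theorem mapAll_comp {U : Type*} [Quiver U] (E : W ⥤q U) (F : U ⥤q V) :
    mapAll (E ⋙q F) = mapAll F ∘ mapAll E := by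
  funext P
  simp only [mapAll, Function.comp_apply, Prefunctor.mapPath_comp_apply]
  rfl

theorem pathMap_ofPath (F : W ⥤q V) {x y : W} (p : Path x y) :
    pathMap k F (ofPath k p) = ofPath k (F.mapPath p) :=
  (pathBasis k W).constr_basis k _ _

theorem repr_pathMap (F : W ⥤q V) (c : PathCoalgebra k W) :
    (pathBasis k V).repr (pathMap k F c) = ((pathBasis k W).repr c).mapDomain (mapAll F) := by
  suffices (pathBasis k V).repr.toLinearMap ∘ₗ (pathMap k F).toLinearMap =
      Finsupp.lmapDomain k k (mapAll F) ∘ₗ (pathBasis k W).repr.toLinearMap from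
    LinearMap.congr_fun this c
  refine linearMap_ext_ofPath fun x y p => ?_
  change (pathBasis k V).repr (pathMap k F (ofPath k p)) =
    ((pathBasis k W).repr (ofPath k p)).mapDomain (mapAll F)
  rw [pathMap_ofPath, repr_ofPath, repr_ofPath, Finsupp.mapDomain_single]
  rfl

theorem pathMap_comp {U : Type*} [Quiver U] (E : W ⥤q U) (F : U ⥤q V) (c : PathCoalgebra k W) :
    pathMap k (E ⋙q F) c = pathMap k F (pathMap k E c) := by
  apply (pathBasis k V).repr.injective
  rw [repr_pathMap, repr_pathMap, repr_pathMap, mapAll_comp, Finsupp.mapDomain_comp]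

theorem exists_of_mem_supp_pathMap {F : W ⥤q V} {c : PathCoalgebra k W} {P : AllPaths V}
    (hP : P ∈ supp (pathMap k F c)) : ∃ R ∈ supp c, mapAll F R = P := by
  classical
  rw [supp, repr_pathMap] at hP
  exact Finset.mem_image.1 (Finsupp.mapDomain_support hP)

theorem pathMap_partialSum_preimage (F : W ⥤q V) (S : Set (AllPaths V)) (c : PathCoalgebra k W) :
    pathMap k F (partialSum (mapAll F ⁻¹' S) c) = partialSum S (pathMap k F c) := by
  classical
  suffices (pathMap k F).toLinearMap ∘ₗ partialSumHom (mapAll F ⁻¹' S) =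
      partialSumHom S ∘ₗ (pathMap k F).toLinearMap from LinearMap.congr_fun this c
  refine linearMap_ext_ofPath fun x y p => ?_
  change pathMap k F (partialSum _ (ofPath k p)) = partialSum S (pathMap k F (ofPath k p))
  rw [pathMap_ofPath, partialSum_ofPath, partialSum_ofPath, apply_ite (pathMap k F), map_zero,
    pathMap_ofPath]
  rfl

theorem pathMap_mem_homPart {F : W ⥤q V} {B : Submodule k (PathCoalgebra k V)}
    {B' : Submodule k (PathCoalgebra k W)} (hBB' : ∀ c ∈ B', pathMap k F c ∈ B)
    {x' y' : W} {c : PathCoalgebra k W} (hc : c ∈ homPart B' x' y') :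
    pathMap k F c ∈ homPart B (F.obj x') (F.obj y') := by
  obtain ⟨hcB, hsupp⟩ := mem_homPart_iff.1 hc
  refine mem_homPart_iff.2 ⟨hBB' c hcB, fun P hP => ?_⟩
  obtain ⟨R, hR, rfl⟩ := exists_of_mem_supp_pathMap hP
  exact ⟨congrArg F.obj (hsupp R hR).1, congrArg F.obj (hsupp R hR).2⟩

end PathMap

section StartsAt

variable {k : Type z} [Field k] {V : Type u} [Quiver.{v} V] {W : Type w} [Quiver.{w'} W]

/-- `b` is a combination of paths that start at `x`. A covering of quivers is injective on such
combinations, for each fixed `x`. -/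
def StartsAt (x : V) (b : PathCoalgebra k V) : Prop := ∀ P ∈ supp b, P.1 = x

theorem startsAt_zero (x : V) : StartsAt x (0 : PathCoalgebra k V) := by simp [StartsAt, supp]

theorem startsAt_ofPath {x y : V} (p : Path x y) : StartsAt x (ofPath k p) := by
  simp [StartsAt, supp_ofPath]

theorem startsAt_of_mem_homPart {B : Submodule k (PathCoalgebra k V)} {x y : V}
    {b : PathCoalgebra k V} (hb : b ∈ homPart B x y) : StartsAt x b :=
  fun P hP => ((mem_homPart_iff.1 hb).2 P hP).1

theorem IsMinimal.startsAt {B : Submodule k (PathCoalgebra k V)} {x y : V}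
    {b : PathCoalgebra k V} (hb : IsMinimal B x y b) : StartsAt x b :=
  startsAt_of_mem_homPart hb.mem

theorem exists_startsAt_of_mem_minimalOrPath {B : Submodule k (PathCoalgebra k V)}
    {b : PathCoalgebra k V} (hb : b ∈ minimalOrPath B) : ∃ x, StartsAt x b := by
  rcases hb with ⟨x, y, hb⟩ | ⟨-, x, y, p, rfl⟩
  exacts [⟨x, hb.startsAt⟩, ⟨x, startsAt_ofPath p⟩]

variable {x' : W} {c d : PathCoalgebra k W}

theorem startsAt_partialSum (hc : StartsAt x' c) (S : Set (AllPaths W)) :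
    StartsAt x' (partialSum S c) :=
  fun P hP => hc P (mem_supp_partialSum.1 hP).1

theorem startsAt_pathMap (F : W ⥤q V) (hc : StartsAt x' c) :
    StartsAt (F.obj x') (pathMap k F c) := by
  intro P hP
  obtain ⟨R, hR, rfl⟩ := exists_of_mem_supp_pathMap hP
  exact congrArg F.obj (hc R hR)

variable {F : W ⥤q V} (hF : F.IsCovering)
include hF

theorem mapAll_injOn (x' : W) : Set.InjOn (mapAll F) {P | P.1 = x'} := by
  rintro ⟨s, P⟩ rfl ⟨t, R⟩ (rfl : t = s) h
  exact congrArg _ ((hF.pathStar_bijective t).1 (a₁ := P) (a₂ := R) (eq_of_heq (Sigma.mk.inj h).2))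

theorem eq_of_pathMap_eq (hc : StartsAt x' c) (hd : StartsAt x' d)
    (h : pathMap k F c = pathMap k F d) : c = d := by
  apply (pathBasis k W).repr.injective
  apply Finsupp.mapDomain_injOn _ (mapAll_injOn hF x') hc hd
  rw [← repr_pathMap, h, repr_pathMap]

theorem card_supp_pathMap (hc : StartsAt x' c) : (supp (pathMap k F c)).card = (supp c).card := by
  classical
  have hinj : Set.InjOn (mapAll F) (supp c) := (mapAll_injOn hF x').mono hc
  rw [supp, repr_pathMap, Finsupp.mapDomain_support_of_injOn _ hinj,
    Finset.card_image_of_injOn (s := ((pathBasis k W).repr c).support) hinj]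
  rfl

theorem exists_pathMap_partialSum (hc : StartsAt x' c) (S : Set (AllPaths W)) :
    ∃ T : Set (AllPaths V), pathMap k F (partialSum S c) = partialSum T (pathMap k F c) := by
  refine ⟨mapAll F '' (S ∩ supp c), ?_⟩
  rw [← pathMap_partialSum_preimage]
  refine congrArg _ (partialSum_congr fun P hP => ?_)
  have hinj : Set.InjOn (mapAll F) (supp c) := (mapAll_injOn hF x').mono hc
  rw [Set.mem_preimage, hinj.mem_image_iff Set.inter_subset_right hP]
  exact (and_iff_left hP).symm

theorem isMinimal_of_pathMap {B : Submodule k (PathCoalgebra k V)}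
    {B' : Submodule k (PathCoalgebra k W)} (hBB' : ∀ c ∈ B', pathMap k F c ∈ B) {y' : W}
    (hc : c ∈ homPart B' x' y') (hmin : IsMinimal B (F.obj x') (F.obj y') (pathMap k F c)) :
    IsMinimal B' x' y' c := by
  have hst : StartsAt x' c := startsAt_of_mem_homPart hc
  refine isMinimal_iff.2 ⟨hc, card_supp_pathMap hF hst ▸ hmin.two_le, fun S hS => ?_⟩
  obtain ⟨T, hT⟩ := exists_pathMap_partialSum hF hst S
  refine ((isMinimal_iff.1 hmin).2.2 T (hT ▸ hBB' _ hS)).imp (fun h0 => ?_) fun hself => ?_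
  · exact eq_of_pathMap_eq hF (startsAt_partialSum hst S) (startsAt_zero x')
      (by rw [hT, h0, map_zero])
  · exact eq_of_pathMap_eq hF (startsAt_partialSum hst S) hst (hT.trans hself)

end StartsAt

section Liftings

variable {k : Type z} [Field k] {V : Type u} [Quiver.{v} V] {W : Type w} [Quiver.{w'} W]
  {F : W ⥤q V} (hF : F.IsCovering)

section Lifting

variable {L : V → W} (hL : ∀ x, F.obj (L x) = x)

theorem liftPath_fst (p : AllPaths V) : (liftPath hF hL p).1 = L p.1 :=
  (existsUnique_lift hF hL p).choose_spec.1.1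

theorem mapAll_liftPath (p : AllPaths V) : mapAll F (liftPath hF hL p) = p :=
  (existsUnique_lift hF hL p).choose_spec.1.2

theorem liftElem_ofPath {x y : V} (p : Path x y) :
    liftElem hF hL (ofPath k p) = ofPath k (liftPath hF hL (toAll p)).2.2 :=
  (pathBasis k V).constr_basis k _ _

theorem repr_liftElem (b : PathCoalgebra k V) :
    (pathBasis k W).repr (liftElem hF hL b) =
      ((pathBasis k V).repr b).mapDomain (liftPath hF hL) := by
  suffices (pathBasis k W).repr.toLinearMap ∘ₗ liftElem hF hL =
      Finsupp.lmapDomain k k (liftPath hF hL) ∘ₗ (pathBasis k V).repr.toLinearMap from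
    LinearMap.congr_fun this b
  refine linearMap_ext_ofPath fun x y p => ?_
  change (pathBasis k W).repr (liftElem hF hL (ofPath k p)) =
    ((pathBasis k V).repr (ofPath k p)).mapDomain (liftPath hF hL)
  rw [liftElem_ofPath, repr_ofPath, repr_ofPath, Finsupp.mapDomain_single]

theorem pathMap_liftElem (b : PathCoalgebra k V) : pathMap k F (liftElem hF hL b) = b := by
  apply (pathBasis k V).repr.injective
  have hcomp : mapAll F ∘ liftPath hF hL = id := funext (mapAll_liftPath hF hL)
  rw [repr_pathMap, repr_liftElem, ← Finsupp.mapDomain_comp, hcomp, Finsupp.mapDomain_id]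

theorem startsAt_liftElem {x : V} {b : PathCoalgebra k V} (hb : StartsAt x b) :
    StartsAt (L x) (liftElem hF hL b) := by
  classical
  intro P hP
  rw [supp, repr_liftElem] at hP
  obtain ⟨R, hR, rfl⟩ := Finset.mem_image.1 (Finsupp.mapDomain_support hP)
  rw [liftPath_fst, hb R hR]

theorem liftElem_pathMap {x' : W} (hx' : L (F.obj x') = x') {c : PathCoalgebra k W}
    (hc : StartsAt x' c) : liftElem hF hL (pathMap k F c) = c :=
  eq_of_pathMap_eq hF (hx' ▸ startsAt_liftElem hF hL (startsAt_pathMap F hc)) hc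
    (pathMap_liftElem hF hL _)

end Lifting

theorem exists_lifting_through (hs : Function.Surjective F.obj) (x' : W) :
    ∃ L : V → W, (∀ x, F.obj (L x) = x) ∧ L (F.obj x') = x' := by
  classical
  refine ⟨Function.update (Function.surjInv hs) (F.obj x') x', fun x => ?_,
    Function.update_self ..⟩
  rcases eq_or_ne x (F.obj x') with rfl | hx
  · rw [Function.update_self]
  · rw [Function.update_of_ne hx, Function.surjInv_eq hs]

variable {B : Submodule k (PathCoalgebra k V)}

theorem pathMap_mem_of_mem_liftSpan {c : PathCoalgebra k W} (hc : c ∈ liftSpan hF B) :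
    pathMap k F c ∈ B := by
  suffices liftSpan hF B ≤ B.comap (pathMap k F).toLinearMap from this hc
  refine Submodule.span_le.2 ?_
  rintro _ ⟨L, hL, b, hb, rfl⟩
  change pathMap k F (liftElem hF hL b) ∈ B
  rw [pathMap_liftElem]
  exact minimalOrPath_subset B hb

theorem liftElem_mem_liftSpan (hB : IsSumOfHomParts B) {L : V → W} (hL : ∀ x, F.obj (L x) = x)
    {b : PathCoalgebra k V} (hb : b ∈ B) : liftElem hF hL b ∈ liftSpan hF B := by
  suffices Submodule.span k (minimalOrPath B) ≤ (liftSpan hF B).comap (liftElem hF hL) from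
    this (hB.span_minimalOrPath.symm ▸ hb)
  exact Submodule.span_le.2 fun b hb => Submodule.subset_span ⟨L, hL, b, hb, rfl⟩

theorem mem_liftSpan_iff (hs : Function.Surjective F.obj) (hB : IsSumOfHomParts B) {x' : W}
    {c : PathCoalgebra k W} (hc : StartsAt x' c) : c ∈ liftSpan hF B ↔ pathMap k F c ∈ B := by
  refine ⟨pathMap_mem_of_mem_liftSpan hF, fun h => ?_⟩
  obtain ⟨L, hL, hx'⟩ := exists_lifting_through hs x'
  exact liftElem_pathMap hF hL hx' hc ▸ liftElem_mem_liftSpan hF hB hL h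

theorem liftSpan_eq_span (hs : Function.Surjective F.obj) (hB : IsSumOfHomParts B) :
    liftSpan hF B = Submodule.span k {c | (∃ x', StartsAt x' c) ∧ pathMap k F c ∈ B} := by
  refine le_antisymm (Submodule.span_mono ?_) (Submodule.span_le.2 ?_)
  · rintro _ ⟨L, hL, b, hb, rfl⟩
    obtain ⟨x, hx⟩ := exists_startsAt_of_mem_minimalOrPath hb
    exact ⟨⟨_, startsAt_liftElem hF hL hx⟩,
      (pathMap_liftElem hF hL b).symm ▸ minimalOrPath_subset B hb⟩
  · rintro c ⟨⟨x', hc⟩, h⟩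
    exact (mem_liftSpan_iff hF hs hB hc).2 h

theorem isMinimal_pathMap (hs : Function.Surjective F.obj) (hB : IsSumOfHomParts B) {x' y' : W}
    {c : PathCoalgebra k W} (hc : IsMinimal (liftSpan hF B) x' y' c) :
    IsMinimal B (F.obj x') (F.obj y') (pathMap k F c) := by
  refine isMinimal_iff.2 ⟨pathMap_mem_homPart (fun _ => pathMap_mem_of_mem_liftSpan hF) hc.mem,
    (card_supp_pathMap hF hc.startsAt).symm ▸ hc.two_le, fun S hS => ?_⟩
  rw [← pathMap_partialSum_preimage] at hS ⊢
  have hmem := (mem_liftSpan_iff hF hs hB (startsAt_partialSum hc.startsAt _)).2 hS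
  exact ((isMinimal_iff.1 hc).2.2 _ hmem).imp (fun h => by rw [h, map_zero]) (congrArg _)

end Liftings

section GaloisCoalgebraCovering

variable {k : Type z} [Field k] {V : Type u} [Quiver.{v} V] {W : Type w} [Quiver.{w'} W]
  {F : W ⥤q V} {B' : Submodule k (PathCoalgebra k W)} {B : Submodule k (PathCoalgebra k V)}

namespace IsGaloisCoalgebraCovering

theorem pathMap_mem (h : IsGaloisCoalgebraCovering F B' B) {c : PathCoalgebra k W}
    (hc : c ∈ B') : pathMap k F c ∈ B :=
  pathMap_mem_of_mem_liftSpan h.isCovering (h.eq_liftSpan ▸ hc)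

theorem exists_liftElem_mem_homPart (h : IsGaloisCoalgebraCovering F B' B) {L : V → W}
    (hL : ∀ x, F.obj (L x) = x) {b : PathCoalgebra k V} (hb : b ∈ minimalOrPath B) :
    ∃ x' y', liftElem h.isCovering hL b ∈ homPart B' x' y' := by
  have hmem : liftElem h.isCovering hL b ∈ B' :=
    h.eq_liftSpan.ge (Submodule.subset_span ⟨L, hL, b, hb, rfl⟩)
  rcases hb with ⟨x, y, hb⟩ | ⟨-, x, y, p, rfl⟩
  · obtain ⟨y', b', hb', rfl⟩ := h.lift_minimal x y b hb (L x) (hL x)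
    have hlift : liftElem h.isCovering hL (pathMap k F b') = b' :=
      eq_of_pathMap_eq h.isCovering (startsAt_liftElem h.isCovering hL hb.startsAt) hb'.startsAt
        (pathMap_liftElem _ _ _)
    exact ⟨L x, y', hlift.symm ▸ hb'.mem⟩
  · rw [liftElem_ofPath] at hmem ⊢
    exact ⟨_, _, ofPath_mem_homPart _ hmem⟩

theorem isSumOfHomParts (h : IsGaloisCoalgebraCovering F B' B) : IsSumOfHomParts B' := by
  refine h.eq_liftSpan.le.trans (Submodule.span_le.2 ?_)
  rintro _ ⟨L, hL, b, hb, rfl⟩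
  obtain ⟨x', y', hmem⟩ := h.exists_liftElem_mem_homPart hL hb
  exact Submodule.mem_iSup_of_mem x' (Submodule.mem_iSup_of_mem y' hmem)

theorem of_comp {U : Type*} [Quiver U] {E : W ⥤q U} {F₁ : U ⥤q V}
    {B₁ : Submodule k (PathCoalgebra k U)} (hB : IsSumOfHomParts B)
    (h : IsGaloisCoalgebraCovering (E ⋙q F₁) B' B) (h₁ : IsGaloisCoalgebraCovering F₁ B₁ B)
    (hE : IsGaloisCovering E) : IsGaloisCoalgebraCovering E B' B₁ where
  toIsGaloisCovering := hE
  eq_liftSpan := by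
    rw [liftSpan_eq_span hE.isCovering hE.surjective h₁.isSumOfHomParts, h.eq_liftSpan,
      liftSpan_eq_span h.isCovering h.surjective hB]
    refine congrArg _ (Set.ext fun c => and_congr_right ?_)
    rintro ⟨x', hc⟩
    rw [pathMap_comp, h₁.eq_liftSpan,
      mem_liftSpan_iff h₁.isCovering h₁.surjective hB (startsAt_pathMap E hc)]
  lift_minimal := by
    rintro x₁ y₁ b₁ hb₁ x' rfl
    have hmin : IsMinimal B (F₁.obj (E.obj x')) (F₁.obj y₁) (pathMap k F₁ b₁) :=
      isMinimal_pathMap h₁.isCovering h₁.surjective hB (h₁.eq_liftSpan ▸ hb₁)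
    obtain ⟨y', b', hb', hb'₁⟩ := h.lift_minimal _ _ _ hmin x' rfl
    rw [pathMap_comp] at hb'₁
    exact ⟨y', b', hb', eq_of_pathMap_eq h₁.isCovering (startsAt_pathMap E hb'.startsAt)
      hb₁.startsAt hb'₁⟩

end IsGaloisCoalgebraCovering

end GaloisCoalgebraCovering

section Walks

variable {V : Type u} [Quiver.{v} V] {W : Type w} [Quiver.{w'} W]

theorem walkClass_induction {x : V} {P : ∀ y : V, WalkClass x y → Prop}
    (nil : P x (𝟙 _))
    (pos : ∀ (y t : V) (γ : WalkClass x y) (a : y ⟶ t), P y γ →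
      P t (γ ≫ (FreeGroupoid.of V).map a))
    (neg : ∀ (y t : V) (γ : WalkClass x y) (a : t ⟶ y), P y γ →
      P t (γ ≫ Groupoid.inv ((FreeGroupoid.of V).map a)))
    {y : V} (γ : WalkClass x y) : P y γ := by
  induction γ using Quot.ind with
  | _ p =>
    change @Path (Symmetrify V) _ x y at p
    induction p with
    | nil => exact nil
    | cons p e ih =>
      rcases e with a | a
      · exact pos _ _ _ a ih
      · exact neg _ _ _ a ih

theorem isConnectedQuiver_iff :
    IsConnectedQuiver V ↔ Nonempty V ∧ ∀ x y : V, Nonempty (WalkClass x y) := by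
  refine and_congr_right fun _ => forall₂_congr fun x y => ⟨?_, ?_⟩
  · rintro ⟨p⟩
    exact ⟨Quot.mk _ p⟩
  · rintro ⟨γ⟩
    obtain ⟨p, -⟩ := Quot.exists_rep γ
    exact ⟨p⟩

/-- The action of a quiver morphism on walk classes. -/
def mapWalk (F : W ⥤q V) {x y : W} (γ : WalkClass x y) : WalkClass (F.obj x) (F.obj y) :=
  (freeGroupoidFunctor F).map γ

section MapWalk

variable (F : W ⥤q V) {x y : W}

@[simp] theorem mapWalk_id (x : W) : mapWalk F (𝟙 ((FreeGroupoid.of W).obj x)) = 𝟙 _ :=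
  (freeGroupoidFunctor F).map_id _

@[simp] theorem mapWalk_comp {t : W} (γ : WalkClass x y) (η : WalkClass y t) :
    mapWalk F (γ ≫ η) = mapWalk F γ ≫ mapWalk F η :=
  (freeGroupoidFunctor F).map_comp _ _

@[simp] theorem mapWalk_inv (γ : WalkClass x y) :
    mapWalk F (Groupoid.inv γ) = Groupoid.inv (mapWalk F γ) := by
  rw [Groupoid.inv_eq_inv, Groupoid.inv_eq_inv]
  exact (freeGroupoidFunctor F).map_inv γ

@[simp] theorem mapWalk_of (a : x ⟶ y) :
    mapWalk F ((FreeGroupoid.of W).map a) = (FreeGroupoid.of V).map (F.map a) :=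
  rfl

theorem mapWalk_prefunctor_comp {U : Type*} [Quiver U] (E : U ⥤q W) {x y : U}
    (γ : WalkClass x y) : mapWalk (E ⋙q F) γ = mapWalk F (mapWalk E γ) := by
  induction γ using walkClass_induction with
  | nil => simp only [mapWalk_id]; rfl
  | pos _ _ _ _ ih => rw [mapWalk_comp, ih, mapWalk_comp, mapWalk_comp]; rfl
  | neg _ _ _ _ ih =>
    rw [mapWalk_comp, mapWalk_inv, ih, mapWalk_comp, mapWalk_comp, mapWalk_inv, mapWalk_inv]
    rfl

end MapWalk

theorem prefunctor_ext {F G : W ⥤q V} (h_obj : ∀ x, F.obj x = G.obj x)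
    (h_map : ∀ {x y : W} (a : x ⟶ y),
      F.map a = homOfEq (G.map a) (h_obj x).symm (h_obj y).symm) : F = G := by
  obtain ⟨fo, fm⟩ := F
  obtain ⟨go, gm⟩ := G
  obtain rfl : fo = go := funext h_obj
  congr 1
  funext x y a
  exact h_map a

theorem pathClass_cons {x y t : V} (p : Path x y) (a : y ⟶ t) :
    pathClass (p.cons a) = pathClass p ≫ (FreeGroupoid.of V).map a := rfl

theorem pathClass_mapPath (F : W ⥤q V) {x y : W} (p : Path x y) :
    pathClass (F.mapPath p) = mapWalk F (pathClass p) := by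
  induction p with
  | nil => exact (mapWalk_id F x).symm
  | cons p a ih => rw [Prefunctor.mapPath_cons, pathClass_cons, pathClass_cons, ih, mapWalk_comp,
      mapWalk_of]

theorem exists_lift_walk {F : W ⥤q V} (hF : F.IsCovering) (x' : W) {y : V}
    (γ : WalkClass (F.obj x') y) :
    ∃ (y' : W) (γ' : WalkClass x' y'),
      (⟨F.obj y', mapWalk F γ'⟩ : Σ y, WalkClass (F.obj x') y) = ⟨y, γ⟩ := by
  induction γ using walkClass_induction with
  | nil => exact ⟨x', 𝟙 _, by rw [mapWalk_id]⟩
  | pos _ t _ a ih =>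
    obtain ⟨y', γ', h⟩ := ih
    cases h
    obtain ⟨⟨t', a'⟩, h⟩ := (hF.star_bijective y').2 ⟨t, a⟩
    cases h
    exact ⟨t', γ' ≫ (FreeGroupoid.of W).map a', by rw [mapWalk_comp, mapWalk_of]⟩
  | neg _ t _ a ih =>
    obtain ⟨y', γ', h⟩ := ih
    cases h
    obtain ⟨⟨t', a'⟩, h⟩ := (hF.costar_bijective y').2 ⟨t, a⟩
    cases h
    exact ⟨t', γ' ≫ Groupoid.inv ((FreeGroupoid.of W).map a'), by
      rw [mapWalk_comp, mapWalk_inv, mapWalk_of]⟩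

theorem surjective_of_isCovering {F : W ⥤q V} (hF : F.IsCovering) [hW : Nonempty W]
    (hV : IsConnectedQuiver V) : Function.Surjective F.obj := by
  intro y
  obtain ⟨x'⟩ := hW
  obtain ⟨γ⟩ := (isConnectedQuiver_iff.1 hV).2 (F.obj x') y
  obtain ⟨y', γ', h⟩ := exists_lift_walk hF x' γ
  exact ⟨y', congrArg Sigma.fst h⟩

end Walks

section Monodromy

variable {V : Type u} [Quiver.{v} V] {W : Type w} [Quiver.{w'} W]

/-- The fibre of a quiver morphism over a vertex. -/
abbrev Fiber (F : W ⥤q V) (x : V) := {x' : W // F.obj x' = x}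

/-- The fibre of a quiver morphism over an arrow. The arrows are bundled with their ends, so that
lying over `a` is an equality rather than a heterogeneous equality. -/
abbrev ArrowFiber (F : W ⥤q V) {x y : V} (a : x ⟶ y) :=
  {e : Σ s t : W, s ⟶ t //
    (⟨F.obj e.1, F.obj e.2.1, F.map e.2.2⟩ : Σ x y : V, x ⟶ y) = ⟨x, y, a⟩}

namespace ArrowFiber

variable {F : W ⥤q V} {x y : V} {a : x ⟶ y}

/-- The source of an arrow over `a`, as a point of the fibre. -/
def source (e : ArrowFiber F a) : Fiber F x := ⟨e.1.1, congrArg (·.1) e.2⟩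

/-- The target of an arrow over `a`, as a point of the fibre. -/
def target (e : ArrowFiber F a) : Fiber F y := ⟨e.1.2.1, congrArg (·.2.1) e.2⟩

theorem source_bijective (hF : F.IsCovering) :
    Function.Bijective (source : ArrowFiber F a → Fiber F x) := by
  constructor
  · rintro ⟨⟨s, t, e⟩, h⟩ ⟨⟨s₂, t₂, e₂⟩, h₂⟩ hs
    obtain rfl : s = s₂ := congrArg Subtype.val hs
    have hstar : F.star s ⟨t, e⟩ = F.star s ⟨t₂, e₂⟩ :=
      eq_of_heq (Sigma.mk.inj (h.trans h₂.symm)).2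
    cases (hF.star_bijective s).1 hstar
    rfl
  · rintro ⟨s, rfl⟩
    obtain ⟨⟨t, e⟩, h⟩ := (hF.star_bijective s).2 ⟨y, a⟩
    cases h
    exact ⟨⟨⟨s, t, e⟩, rfl⟩, rfl⟩

theorem costar_mk_eq_of_sigma_eq {x₁ x₂ y : V} {a₁ : x₁ ⟶ y} {a₂ : x₂ ⟶ y}
    (h : (⟨x₁, y, a₁⟩ : Σ x y : V, x ⟶ y) = ⟨x₂, y, a₂⟩) :
    (⟨x₁, a₁⟩ : Quiver.Costar y) = ⟨x₂, a₂⟩ := by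
  cases h
  rfl

theorem target_bijective (hF : F.IsCovering) :
    Function.Bijective (target : ArrowFiber F a → Fiber F y) := by
  constructor
  · rintro ⟨⟨s, t, e⟩, h⟩ ⟨⟨s₂, t₂, e₂⟩, h₂⟩ ht
    obtain rfl : t = t₂ := congrArg Subtype.val ht
    have hcostar : F.costar t ⟨s, e⟩ = F.costar t ⟨s₂, e₂⟩ :=
      costar_mk_eq_of_sigma_eq (h.trans h₂.symm)
    cases (hF.costar_bijective t).1 hcostar
    rfl
  · rintro ⟨t, rfl⟩
    obtain ⟨⟨s, e⟩, h⟩ := (hF.costar_bijective t).2 ⟨x, a⟩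
    cases h
    exact ⟨⟨⟨s, t, e⟩, rfl⟩, rfl⟩

end ArrowFiber

section Transport

variable {F : W ⥤q V} (hF : F.IsCovering) {x y : V}

/-- The bijection of fibres that takes the source of each arrow over `a` to its target. -/
def arrowTransport (a : x ⟶ y) : Fiber F x ≃ Fiber F y :=
  (Equiv.ofBijective _ (ArrowFiber.source_bijective (a := a) hF)).symm.trans
    (Equiv.ofBijective _ (ArrowFiber.target_bijective hF))

theorem arrowTransport_map {s t : W} (a : s ⟶ t) :
    arrowTransport hF (F.map a) ⟨s, rfl⟩ = ⟨t, rfl⟩ :=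
  congrArg ArrowFiber.target <|
    Equiv.ofBijective_symm_apply_apply _ (ArrowFiber.source_bijective hF) ⟨⟨s, t, a⟩, rfl⟩

theorem exists_map_eq_homOfEq_arrowTransport (a : x ⟶ y) (s : Fiber F x) :
    ∃ a' : s.1 ⟶ (arrowTransport hF a s).1,
      F.map a' = homOfEq a s.2.symm (arrowTransport hF a s).2.symm := by
  obtain ⟨s, rfl⟩ := s
  obtain ⟨⟨t, a'⟩, h⟩ := (hF.star_bijective s).2 ⟨y, a⟩
  cases h
  rw [arrowTransport_map]
  exact ⟨a', rfl⟩

/-- The monodromy functor of a covering. The groupoid of types and bijections is encoded as the core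
of the category of types. -/
def monodromy : Quiver.FreeGroupoid V ⥤ Core (Type w) :=
  FreeGroupoid.lift
    { obj := fun x => Core.mk (Fiber F x)
      map := fun a => CoreHom.mk (arrowTransport hF a).toIso }

/-- The bijection of fibres that belongs to a walk class. -/
def transport (γ : WalkClass x y) : Fiber F x ≃ Fiber F y :=
  ((monodromy hF).map γ).iso.toEquiv

@[simp] theorem transport_id (x : V) (s : Fiber F x) :
    transport hF (𝟙 ((FreeGroupoid.of V).obj x)) s = s := by
  rw [transport, (monodromy hF).map_id]; rfl

@[simp] theorem transport_comp {t : V} (γ : WalkClass x y) (η : WalkClass y t) (s : Fiber F x) :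
    transport hF (γ ≫ η) s = transport hF η (transport hF γ s) := by
  rw [transport, (monodromy hF).map_comp]; rfl

@[simp] theorem transport_inv (γ : WalkClass x y) (s : Fiber F y) :
    transport hF (Groupoid.inv γ) s = (transport hF γ).symm s := by
  rw [Equiv.eq_symm_apply, ← transport_comp, Groupoid.inv_comp, transport_id]

@[simp] theorem transport_of (a : x ⟶ y) :
    transport hF ((FreeGroupoid.of V).map a) = arrowTransport hF a :=
  rfl

theorem transport_mapWalk {x y : W} (γ : WalkClass x y) :
    transport hF (mapWalk F γ) ⟨x, rfl⟩ = ⟨y, rfl⟩ := by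
  induction γ using walkClass_induction with
  | nil => rw [mapWalk_id, transport_id]
  | pos _ _ _ a ih => rw [mapWalk_comp, mapWalk_of, transport_comp, ih, transport_of,
      arrowTransport_map]
  | neg _ _ _ a ih => rw [mapWalk_comp, mapWalk_inv, mapWalk_of, transport_comp, transport_inv, ih,
      transport_of, Equiv.symm_apply_eq, arrowTransport_map]

theorem exists_mapWalk_eq_iff {x y : W} (γ : WalkClass (F.obj x) (F.obj y)) :
    (∃ γ' : WalkClass x y, mapWalk F γ' = γ) ↔ transport hF γ ⟨x, rfl⟩ = ⟨y, rfl⟩ := by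
  constructor
  · rintro ⟨γ, rfl⟩
    exact transport_mapWalk hF γ
  · intro h
    obtain ⟨y', γ', e⟩ := exists_lift_walk hF x γ
    have hend := congrArg
      (fun r : Σ t, WalkClass (F.obj x) t => (transport hF r.2 ⟨x, rfl⟩).1) e
    obtain rfl : y' = y := by simpa only [transport_mapWalk, h] using hend
    exact ⟨γ', eq_of_heq (Sigma.mk.inj e).2⟩

theorem mem_range_mapEnd_iff (x : W) (β : Pi1 V (F.obj x)) :
    β ∈ ((freeGroupoidFunctor F).mapEnd ((FreeGroupoid.of W).obj x)).range ↔
      transport hF (β : WalkClass (F.obj x) (F.obj x)) ⟨x, rfl⟩ = ⟨x, rfl⟩ :=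
  exists_mapWalk_eq_iff hF (x := x) (y := x) β

end Transport

section Lifts

variable {U : Type*} [Quiver U]

theorem coe_transport_mapWalk {E : W ⥤q U} {F₁ : U ⥤q V} (hE : E.IsCovering)
    (hEF : (E ⋙q F₁).IsCovering) (x : W) {u : U} (β : WalkClass (E.obj x) u) :
    (transport hEF (mapWalk F₁ β) ⟨x, rfl⟩).1 = (transport hE β ⟨x, rfl⟩).1 := by
  obtain ⟨y, γ, e⟩ := exists_lift_walk hE x β
  cases e
  rw [transport_mapWalk, ← mapWalk_prefunctor_comp]
  exact congrArg Subtype.val (transport_mapWalk hEF γ)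

variable {F₁ : U ⥤q V} (hF₁ : F₁.IsCovering)
include hF₁

theorem transport_mapWalk_of_comp_eq {E : W ⥤q U} {F : W ⥤q V} (h : E ⋙q F₁ = F) {x y : W}
    (γ : WalkClass x y) :
    transport hF₁ (mapWalk F γ) ⟨E.obj x, Prefunctor.congr_obj h x⟩ =
      ⟨E.obj y, Prefunctor.congr_obj h y⟩ := by
  subst h
  rw [mapWalk_prefunctor_comp]
  exact transport_mapWalk hF₁ (mapWalk E γ)

theorem obj_eq_of_comp_eq_of_obj_eq {E E' : W ⥤q U} (h : E ⋙q F₁ = E' ⋙q F₁) {x y : W}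
    (γ : WalkClass x y) (hx : E.obj x = E'.obj x) : E.obj y = E'.obj y := by
  have hE := transport_mapWalk_of_comp_eq hF₁ h γ
  have hE' := transport_mapWalk_of_comp_eq hF₁ (E := E') rfl γ
  simp only [hx, hE'] at hE
  exact congrArg Subtype.val hE.symm

theorem eq_of_comp_eq_of_obj_eq {E E' : W ⥤q U} (hW : IsConnectedQuiver W)
    (h : E ⋙q F₁ = E' ⋙q F₁) {x₀ : W} (h₀ : E.obj x₀ = E'.obj x₀) : E = E' := by
  have hobj : ∀ y, E.obj y = E'.obj y := fun y =>
    obj_eq_of_comp_eq_of_obj_eq hF₁ h ((isConnectedQuiver_iff.1 hW).2 x₀ y).some h₀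
  refine prefunctor_ext hobj fun {x y} a => hF₁.map_injective _ ?_
  refine (Prefunctor.congr_hom h.symm a).symm.trans ?_
  exact (Prefunctor.homOfEq_map F₁ _ _ _).symm

theorem exists_lift_of_forall_transport_eq {F : W ⥤q V} (e : ∀ y : W, Fiber F₁ (F.obj y))
    (he : ∀ {y t : W} (a : y ⟶ t), arrowTransport hF₁ (F.map a) (e y) = e t) :
    ∃ E : W ⥤q U, E ⋙q F₁ = F ∧ ∀ y, E.obj y = (e y).1 := by
  have hmap : ∀ {y t : W} (a : y ⟶ t), ∃ a' : (e y).1 ⟶ (e t).1,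
      F₁.map a' = homOfEq (F.map a) (e y).2.symm (e t).2.symm := fun {y t} a =>
    he a ▸ exists_map_eq_homOfEq_arrowTransport hF₁ (F.map a) (e y)
  choose m hm using @hmap
  exact ⟨⟨fun y => (e y).1, m⟩, prefunctor_ext (fun y => (e y).2) fun a => hm a, fun _ => rfl⟩

theorem exists_lift_of_transport_eq {F : W ⥤q V} (hW : IsConnectedQuiver W) {x₀ : W}
    (u₀ : Fiber F₁ (F.obj x₀))
    (h : ∀ γ : WalkClass x₀ x₀, transport hF₁ (mapWalk F γ) u₀ = u₀) :
    ∃ E : W ⥤q U, E ⋙q F₁ = F ∧ E.obj x₀ = u₀.1 := by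
  let γ : ∀ y : W, WalkClass x₀ y := fun y => ((isConnectedQuiver_iff.1 hW).2 x₀ y).some
  let e : ∀ y : W, Fiber F₁ (F.obj y) := fun y => transport hF₁ (mapWalk F (γ y)) u₀
  have he : ∀ {y : W} (η : WalkClass x₀ y), transport hF₁ (mapWalk F η) u₀ = e y := by
    intro y η
    have hloop := h (η ≫ Groupoid.inv (γ y))
    rwa [mapWalk_comp, mapWalk_inv, transport_comp, transport_inv, Equiv.symm_apply_eq] at hloop
  obtain ⟨E, hE, hobj⟩ := exists_lift_of_forall_transport_eq hF₁ e fun {y t} a => by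
    rw [← he (γ y ≫ (FreeGroupoid.of W).map a), mapWalk_comp, mapWalk_of, transport_comp,
      transport_of]
  refine ⟨E, hE, ?_⟩
  rw [hobj, ← he (𝟙 _), mapWalk_id, transport_id]

theorem IsGaloisCovering.of_comp {E : W ⥤q U} (h : IsGaloisCovering (E ⋙q F₁))
    (hU : IsConnectedQuiver U) : IsGaloisCovering E where
  connected_source := h.connected_source
  connected_target := hU
  surjective :=
    haveI := h.connected_source.1
    surjective_of_isCovering (.of_comp_right _ _ hF₁ h.isCovering) hU
  isCovering := .of_comp_right _ _ hF₁ h.isCovering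
  normal x := by
    have hE : E.IsCovering := .of_comp_right _ _ hF₁ h.isCovering
    have hstab (β : WalkClass (E.obj x) (E.obj x)) : transport hE β ⟨x, rfl⟩ = ⟨x, rfl⟩ ↔
        transport h.isCovering (mapWalk F₁ β) ⟨x, rfl⟩ = ⟨x, rfl⟩ :=
      have hval := coe_transport_mapWalk hE h.isCovering x β
      ⟨fun e => Subtype.ext (hval.trans (congrArg Subtype.val e)),
        fun e => Subtype.ext (hval.symm.trans (congrArg Subtype.val e))⟩
    have hrange : ((freeGroupoidFunctor E).mapEnd ((FreeGroupoid.of W).obj x)).range =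
        (((freeGroupoidFunctor (E ⋙q F₁)).mapEnd ((FreeGroupoid.of W).obj x)).range).comap
          ((freeGroupoidFunctor F₁).mapEnd ((FreeGroupoid.of U).obj (E.obj x))) := by
      ext β
      exact (mem_range_mapEnd_iff hE x β).trans
        ((hstab β).trans (mem_range_mapEnd_iff h.isCovering x (mapWalk F₁ β)).symm)
    rw [hrange]
    exact (h.normal x).comap _

end Lifts

end Monodromy

section Homogeneous

variable {k : Type z} [Field k] {V : Type u} [Quiver.{v} V] {G : Type w} [Group G]
  {δ : ArrowWeighting V G} {B : Submodule k (PathCoalgebra k V)}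

/-- `b` is homogeneous of degree `g`: all paths that occur in `b` have weight `g`. -/
def HasWeight (δ : ArrowWeighting V G) (g : G) (b : PathCoalgebra k V) : Prop :=
  ∀ P ∈ supp b, pathWeight δ P.2.2 = g

theorem hasWeight_ofPath (δ : ArrowWeighting V G) {x y : V} (p : Path x y) :
    HasWeight δ (pathWeight δ p) (ofPath k p) := by
  simp [HasWeight, supp_ofPath]

theorem partialSum_weight_mem {b : PathCoalgebra k V} (hb : b ∈ B)
    (hw : ∃ g', HasWeight δ g' b) (g : G) :
    partialSum {P | pathWeight δ P.2.2 = g} b ∈ B := by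
  obtain ⟨g', hg'⟩ := hw
  rcases eq_or_ne g' g with rfl | hne
  · have hself : partialSum {P : AllPaths V | pathWeight δ P.2.2 = g'} b = b :=
      partialSum_eq_self_iff.2 hg'
    rwa [hself]
  · have h0 : partialSum {P : AllPaths V | pathWeight δ P.2.2 = g} b = 0 :=
      partialSum_eq_zero_iff.2 fun P hP hPg => hne ((hg' P hP).symm.trans hPg)
    exact h0 ▸ B.zero_mem

theorem isHomogeneousSub_of_minimal (hB : IsSumOfHomParts B)
    (h : ∀ x y b, IsMinimal B x y b → ∃ g, HasWeight δ g b) : IsHomogeneousSub δ B := by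
  intro b hb g
  suffices Submodule.span k (minimalOrPath B) ≤
      B.comap (partialSumHom {P | pathWeight δ P.2.2 = g}) from
    this (hB.span_minimalOrPath.symm ▸ hb)
  refine Submodule.span_le.2 fun b hb =>
    partialSum_weight_mem (minimalOrPath_subset B hb) ?_ g
  rcases hb with ⟨x, y, hb⟩ | ⟨-, x, y, p, rfl⟩
  exacts [h x y b hb, ⟨_, hasWeight_ofPath δ p⟩]

theorem IsHomogeneousSub.le_of_forall_hasWeight (hB : IsHomogeneousSub δ B)
    {M : Submodule k (PathCoalgebra k V)} (h : ∀ b ∈ B, ∀ g, HasWeight δ g b → b ∈ M) :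
    B ≤ M := by
  classical
  intro b hb
  rw [← sum_partialSum_fiber (fun P => pathWeight δ P.2.2) b _
    fun P hP => Finset.mem_image_of_mem _ hP]
  exact Submodule.sum_mem _ fun g _ =>
    h _ (hB b hb g) g fun P hP => (mem_supp_partialSum.1 hP).2

end Homogeneous

section SmashCovering

variable {k : Type z} [Field k] {V : Type u} [Quiver.{v} V] {G : Type w}
  (δ : ArrowWeighting V G) {B : Submodule k (PathCoalgebra k V)}

theorem smashElem_ofPath (g : G) {x y : V} (p : Path x y) :
    smashElem δ g (ofPath k p) = smashPath k δ p g :=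
  (pathBasis k V).constr_basis k _ _

theorem smashElem_mem_smashSub (g : G) {b : PathCoalgebra k V} (hb : b ∈ B) :
    smashElem δ g b ∈ smashSub δ B :=
  Submodule.mem_iSup_of_mem g ⟨b, hb, rfl⟩

variable [Group G]

theorem smashProj_isCovering : (smashProj δ).IsCovering where
  star_bijective := smashProj_star_bijective δ
  costar_bijective X := by
    constructor
    · rintro ⟨⟨y, h⟩, a, ha⟩ ⟨⟨y', h'⟩, a', ha'⟩ e
      obtain ⟨rfl : y = y', hheq⟩ := Sigma.mk.inj e
      obtain rfl : a = a' := eq_of_heq hheq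
      obtain rfl : h = h' := mul_left_cancel (ha.symm.trans ha')
      rfl
    · rintro ⟨y, a⟩
      exact ⟨⟨⟨y, (δ a)⁻¹ * X.deg⟩, ⟨a, (mul_inv_cancel_left _ _).symm⟩⟩, rfl⟩

theorem smashProj_surjective : Function.Surjective (smashProj δ).obj := fun x => ⟨⟨x, 1⟩, rfl⟩

/-- The lifting `x ↦ x ⋊ g` of the vertices along `Q ⋊ G → Q`; extended to the path coalgebra it
is `b ↦ b ⋊ g`. -/
def constLift (g : G) (x : V) : SmashQuiver δ := ⟨x, g⟩

theorem smashProj_constLift (g : G) (x : V) : (smashProj δ).obj (constLift δ g x) = x := rfl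

theorem smashIso_ofPath {X Y : SmashQuiver δ} (p : Path X Y) :
    smashIso k δ (ofPath k p) = smashPath k δ ((smashProj δ).mapPath p) X.deg :=
  (pathBasis k _).constr_basis k _ _

theorem smashIso_liftElem (g : G) (b : PathCoalgebra k V) :
    smashIso k δ (liftElem (smashProj_isCovering δ) (smashProj_constLift δ g) b) =
      smashElem δ g b := by
  suffices (smashIso k δ).toLinearEquiv.toLinearMap ∘ₗ
      liftElem (smashProj_isCovering δ) (smashProj_constLift δ g) = smashElem δ g from
    LinearMap.congr_fun this b
  refine linearMap_ext_ofPath fun x y p => ?_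
  change smashIso k δ (liftElem _ _ (ofPath k p)) = _
  rw [liftElem_ofPath, smashIso_ofPath, smashElem_ofPath]
  exact congrArg (smashBasis k δ) <| Prod.ext (mapAll_liftPath _ _ (toAll p))
    (congrArg SmashQuiver.deg (liftPath_fst _ _ (toAll p)))

theorem mem_smashCover {c : PathCoalgebra k (SmashQuiver δ)} :
    c ∈ smashCover δ B ↔ smashIso k δ c ∈ smashSub δ B := Iff.rfl

theorem liftElem_mem_smashCover (g : G) {b : PathCoalgebra k V} (hb : b ∈ B) :
    liftElem (smashProj_isCovering δ) (smashProj_constLift δ g) b ∈ smashCover δ B := by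
  rw [mem_smashCover, smashIso_liftElem]
  exact smashElem_mem_smashSub δ g hb

theorem smashCover_eq_liftSpan (hB : IsSumOfHomParts B) :
    smashCover δ B = liftSpan (smashProj_isCovering δ) B := by
  apply le_antisymm
  · intro c hc
    suffices smashSub δ B ≤ (liftSpan (smashProj_isCovering δ) B).map
        (smashIso k δ).toLinearEquiv.toLinearMap by
      obtain ⟨d, hd, hdc⟩ := this hc
      rwa [← (smashIso k δ).toLinearEquiv.injective hdc]
    refine iSup_le fun g => ?_
    rintro _ ⟨b, hb, rfl⟩
    exact ⟨_, liftElem_mem_liftSpan _ hB _ hb, smashIso_liftElem δ g b⟩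
  · rw [liftSpan_eq_span _ (smashProj_surjective δ) hB]
    refine Submodule.span_le.2 ?_
    rintro c ⟨⟨⟨x, g⟩, hc⟩, hcB⟩
    rw [← liftElem_pathMap (smashProj_isCovering δ) (smashProj_constLift δ g) rfl hc]
    exact liftElem_mem_smashCover δ g hcB

variable {δ} in
theorem HasWeight.liftElem_mem_homPart {g : G} {b : PathCoalgebra k V} (hg : HasWeight δ g b)
    {x y : V} (hb : b ∈ homPart B x y) (h : G) :
    liftElem (smashProj_isCovering δ) (smashProj_constLift δ h) b ∈
      homPart (smashCover δ B) ⟨x, h⟩ ⟨y, g * h⟩ := by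
  classical
  obtain ⟨hbB, hsupp⟩ := mem_homPart_iff.1 hb
  refine mem_homPart_iff.2 ⟨liftElem_mem_smashCover δ h hbB, fun P hP => ?_⟩
  rw [supp, repr_liftElem] at hP
  obtain ⟨R, hR, rfl⟩ := Finset.mem_image.1 (Finsupp.mapDomain_support hP)
  have hsource : (liftPath (smashProj_isCovering δ) (smashProj_constLift δ h) R).1 = ⟨x, h⟩ := by
    rw [liftPath_fst, (hsupp R hR).1]
    rfl
  have hdeg := smashQuiver_deg δ
    (liftPath (smashProj_isCovering δ) (smashProj_constLift δ h) R).2.2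
  have hproj := mapAll_liftPath (smashProj_isCovering δ) (smashProj_constLift δ h) R
  generalize liftPath (smashProj_isCovering δ) (smashProj_constLift δ h) R = P at *
  subst hproj
  refine ⟨hsource, SmashQuiver.ext (hsupp _ hR).2 ?_⟩
  exact hdeg.symm.trans (congrArg₂ (· * ·) (hg _ hR) (congrArg SmashQuiver.deg hsource))

theorem smashCover_lift_minimal (hB : IsSumOfHomParts B) {x y : V} {b : PathCoalgebra k V}
    (hb : IsMinimal B x y b) (hw : ∃ g, HasWeight δ g b) {X : SmashQuiver δ}
    (hX : (smashProj δ).obj X = x) :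
    ∃ (Y : SmashQuiver δ) (c : PathCoalgebra k (SmashQuiver δ)),
      IsMinimal (smashCover δ B) X Y c ∧ pathMap k (smashProj δ) c = b := by
  subst hX
  obtain ⟨g, hg⟩ := hw
  have hlift := pathMap_liftElem (smashProj_isCovering δ) (smashProj_constLift δ X.deg) b
  refine ⟨⟨y, g * X.deg⟩, _, ?_, hlift⟩
  refine isMinimal_of_pathMap (smashProj_isCovering δ) (B := B) (fun c hc => ?_)
    (hg.liftElem_mem_homPart hb.mem X.deg) (hlift.symm ▸ hb)
  exact pathMap_mem_of_mem_liftSpan _ (smashCover_eq_liftSpan δ hB ▸ hc)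

end SmashCovering

section SmashSubcoalgebra

variable {k : Type z} [Field k] {V : Type u} [Quiver.{v} V] {G : Type w} [Group G]
  (δ : ArrowWeighting V G) {B : Submodule k (PathCoalgebra k V)}

/-- The linear map `r ⊗ q ↦ (r ⋊ δ(q) g) ⊗ (q ⋊ g)` for paths `q` and `r`, which turns `Δ(b)` into
`Δ(b ⋊ g)`. -/
def smashTwist (g : G) : PathCoalgebra k V ⊗[k] PathCoalgebra k V →ₗ[k]
    SmashCoproduct k δ ⊗[k] SmashCoproduct k δ :=
  TensorProduct.lift (((pathBasis k V).constr k fun P =>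
    (TensorProduct.mk k _ _).flip (smashPath k δ P.2.2 g) ∘ₗ
      smashElem δ (pathWeight δ P.2.2 * g)).flip)

theorem smashTwist_tmul_ofPath (g : G) (b : PathCoalgebra k V) {x y : V} (q : Path x y) :
    smashTwist δ g (b ⊗ₜ ofPath k q) =
      smashElem δ (pathWeight δ q * g) b ⊗ₜ smashPath k δ q g := by
  rw [smashTwist, TensorProduct.lift.tmul, LinearMap.flip_apply, ofPath,
    Module.Basis.constr_basis]
  rfl

theorem comul_smashElem (g : G) (b : PathCoalgebra k V) :
    Coalgebra.comul (R := k) (smashElem δ g b) = smashTwist δ g (Coalgebra.comul (R := k) b) := by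
  suffices Coalgebra.comul ∘ₗ smashElem δ g = smashTwist δ g ∘ₗ Coalgebra.comul from
    LinearMap.congr_fun this b
  refine linearMap_ext_ofPath fun x y p => ?_
  change Coalgebra.comul (smashElem δ g (ofPath k p)) =
    smashTwist δ g (Coalgebra.comul (ofPath k p))
  simp only [smashElem_ofPath, comul_smashPath, comul_ofPath, map_list_sum, List.map_map,
    Function.comp_def, smashTwist_tmul_ofPath]

theorem smashTwist_tmul {g h : G} (b : PathCoalgebra k V) {c : PathCoalgebra k V}
    (hc : HasWeight δ h c) :
    smashTwist δ g (b ⊗ₜ c) = smashElem δ (h * g) b ⊗ₜ smashElem δ g c := by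
  rw [← (pathBasis k V).linearCombination_repr c, Finsupp.linearCombination_apply, Finsupp.sum,
    TensorProduct.tmul_sum, map_sum, map_sum, TensorProduct.tmul_sum]
  refine Finset.sum_congr rfl fun P hP => ?_
  have hbasis : pathBasis k V P = ofPath k P.2.2 := rfl
  rw [TensorProduct.tmul_smul, map_smul, map_smul, TensorProduct.tmul_smul, hbasis,
    smashTwist_tmul_ofPath, smashElem_ofPath, hc P hP]

theorem smashTwist_mem (hδ : IsHomogeneousSub δ B) (g : G) (t : B ⊗[k] B) :
    smashTwist δ g (TensorProduct.map B.subtype B.subtype t) ∈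
      LinearMap.range (TensorProduct.map (smashSub δ B).subtype (smashSub δ B).subtype) := by
  set R := LinearMap.range (TensorProduct.map (smashSub δ B).subtype (smashSub δ B).subtype)
  induction t using TensorProduct.induction_on with
  | zero => simp only [map_zero, R.zero_mem]
  | add t t' ht ht' => simpa only [map_add] using R.add_mem ht ht'
  | tmul b c =>
    suffices B ≤ R.comap (smashTwist δ g ∘ₗ TensorProduct.mk k _ _ b.1) from this c.2
    refine hδ.le_of_forall_hasWeight fun c hc h hw => ?_
    change smashTwist δ g (b.1 ⊗ₜ c) ∈ R
    rw [smashTwist_tmul δ b.1 hw]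
    exact ⟨⟨_, smashElem_mem_smashSub δ _ b.2⟩ ⊗ₜ ⟨_, smashElem_mem_smashSub δ g hc⟩, rfl⟩

theorem smashSub_isSubcoalgebra (hB : IsSubcoalgebra B) (hδ : IsHomogeneousSub δ B) :
    IsSubcoalgebra (smashSub δ B) := by
  suffices smashSub δ B ≤ (LinearMap.range (TensorProduct.map (smashSub δ B).subtype
      (smashSub δ B).subtype)).comap Coalgebra.comul from fun c hc => this hc
  refine iSup_le fun g => ?_
  rintro _ ⟨b, hb, rfl⟩
  obtain ⟨t, ht⟩ := hB b hb
  rw [Submodule.mem_comap, comul_smashElem, ← ht]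
  exact smashTwist_mem δ hδ g t

theorem smashCover_isSubcoalgebra (hB : IsSubcoalgebra B) (hδ : IsHomogeneousSub δ B) :
    IsSubcoalgebra (smashCover δ B) := by
  have hmap : (smashSub δ B).map (smashIso k δ).symm.toCoalgHom.toLinearMap = smashCover δ B :=
    Submodule.map_equiv_eq_comap_symm (smashIso k δ).symm.toLinearEquiv _
  exact hmap ▸ (smashSub_isSubcoalgebra δ hB hδ).map (smashIso k δ).symm.toCoalgHom

theorem ofPath_mem_smashCover {X Y : SmashQuiver δ} {p : Path X Y}
    (hp : ofPath k ((smashProj δ).mapPath p) ∈ B) : ofPath k p ∈ smashCover δ B := by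
  rw [mem_smashCover, smashIso_ofPath, ← smashElem_ofPath]
  exact smashElem_mem_smashSub δ X.deg hp

theorem smashCover_isAdmissible (hB : IsAdmissible B) (hδ : IsHomogeneousSub δ B) :
    IsAdmissible (smashCover δ B) where
  isSubcoalgebra := smashCover_isSubcoalgebra δ hB.isSubcoalgebra hδ
  vertex_mem X := ofPath_mem_smashCover δ (hB.vertex_mem X.vertex)
  arrow_mem a := ofPath_mem_smashCover δ (hB.arrow_mem a.1)

end SmashSubcoalgebra

section WalkWeight

variable {V : Type u} [Quiver.{v} V] {G : Type w} [Group G] (δ : ArrowWeighting V G)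

/-- The extension of an arrow weighting to walk classes. The group is encoded as a groupoid with
one object, so that composition of walks becomes multiplication in the reverse order. -/
def walkWeight {x y : V} (γ : WalkClass x y) : G :=
  (FreeGroupoid.lift
    { obj := fun _ : V => CategoryTheory.SingleObj.star G, map := fun a => δ a }).map γ

theorem walkWeight_id (x : V) : walkWeight δ (𝟙 ((FreeGroupoid.of V).obj x)) = 1 :=
  CategoryTheory.Functor.map_id _ _

theorem walkWeight_comp {x y t : V} (γ : WalkClass x y) (η : WalkClass y t) :
    walkWeight δ (γ ≫ η) = walkWeight δ η * walkWeight δ γ :=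
  CategoryTheory.Functor.map_comp _ _ _

theorem walkWeight_of {x y : V} (a : x ⟶ y) :
    walkWeight δ ((FreeGroupoid.of V).map a) = δ a :=
  mul_one (δ a)

theorem walkWeight_inv {x y : V} (γ : WalkClass x y) :
    walkWeight δ (Groupoid.inv γ) = (walkWeight δ γ)⁻¹ := by
  refine eq_inv_of_mul_eq_one_left ?_
  rw [← walkWeight_comp, Groupoid.comp_inv, walkWeight_id]

theorem walkWeight_conj_eq_one {x y : V} (γ : WalkClass x y) {β : WalkClass x x}
    (hβ : walkWeight δ β = 1) : walkWeight δ (Groupoid.inv γ ≫ β ≫ γ) = 1 := by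
  rw [walkWeight_comp, walkWeight_comp, hβ, walkWeight_inv, mul_one, mul_inv_cancel]

theorem walkWeight_pathClass {x y : V} (p : Path x y) :
    walkWeight δ (pathClass p) = pathWeight δ p := by
  induction p with
  | nil => exact walkWeight_id δ x
  | cons p a ih => rw [pathWeight, ← ih, pathClass_cons, walkWeight_comp, walkWeight_of]

theorem deg_arrowTransport {x y : V} (a : x ⟶ y) (s : Fiber (smashProj δ) x) :
    (arrowTransport (smashProj_isCovering δ) a s).1.deg = δ a * s.1.deg := by
  obtain ⟨X, rfl⟩ := s
  exact congrArg (·.1.deg) (arrowTransport_map (smashProj_isCovering δ)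
    (⟨a, rfl⟩ : X ⟶ (⟨y, δ a * X.deg⟩ : SmashQuiver δ)))

theorem deg_transport {x y : V} (γ : WalkClass x y) (s : Fiber (smashProj δ) x) :
    (transport (smashProj_isCovering δ) γ s).1.deg = walkWeight δ γ * s.1.deg := by
  induction γ using walkClass_induction with
  | nil => rw [transport_id, walkWeight_id, one_mul]
  | pos _ _ _ _ ih => rw [transport_comp, transport_of, deg_arrowTransport, ih, walkWeight_comp,
      walkWeight_of, mul_assoc]
  | neg _ _ _ _ ih => rw [transport_comp, transport_inv, transport_of, walkWeight_comp,
      walkWeight_inv, walkWeight_of, mul_assoc, ← ih, eq_inv_mul_iff_mul_eq, ← deg_arrowTransport,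
      Equiv.apply_symm_apply]

theorem exists_mapWalk_smashProj_eq_iff {X Y : SmashQuiver δ}
    (γ : WalkClass X.vertex Y.vertex) :
    (∃ γ' : WalkClass X Y, mapWalk (smashProj δ) γ' = γ) ↔ walkWeight δ γ * X.deg = Y.deg := by
  refine (exists_mapWalk_eq_iff (smashProj_isCovering δ) γ).trans ?_
  have hdeg := deg_transport δ γ ⟨X, rfl⟩
  refine ⟨fun h => hdeg.symm.trans (congrArg (·.1.deg) h), fun h => ?_⟩
  exact Subtype.ext (SmashQuiver.ext
    (transport (smashProj_isCovering δ) γ ⟨X, rfl⟩).2 (hdeg.trans h))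

theorem mem_range_mapEnd_smashProj_iff (X : SmashQuiver δ) (β : Pi1 V X.vertex) :
    β ∈ ((freeGroupoidFunctor (smashProj δ)).mapEnd
      ((FreeGroupoid.of (SmashQuiver δ)).obj X)).range ↔
      walkWeight δ (β : WalkClass X.vertex X.vertex) = 1 :=
  (exists_mapWalk_smashProj_eq_iff δ (X := X) (Y := X) β).trans mul_eq_right

theorem smashProj_isGaloisCovering (hV : IsConnectedQuiver V)
    (hδ : IsConnectedQuiver (SmashQuiver δ)) : IsGaloisCovering (smashProj δ) where
  connected_source := hδ
  connected_target := hV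
  surjective := smashProj_surjective δ
  isCovering := smashProj_isCovering δ
  normal X := by
    refine ⟨fun β hβ g => (mem_range_mapEnd_smashProj_iff δ X _).2 ?_⟩
    have hβ' := (mem_range_mapEnd_smashProj_iff δ X β).1 hβ
    exact walkWeight_conj_eq_one δ g hβ'

end WalkWeight

section UniversalWeighting

variable {k : Type z} [Field k] {V : Type u} [Quiver.{v} V]
  (B : Submodule k (PathCoalgebra k V)) {x₀ : V} (c : ∀ x : V, WalkClass x₀ x)

theorem walkWeight_universalWeighting {x y : V} (γ : WalkClass x y) :
    walkWeight (universalWeighting B x₀ c) γ =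
      QuotientGroup.mk (End.of (c x ≫ γ ≫ Groupoid.inv (c y))) := by
  induction γ using walkClass_induction with
  | nil =>
    rw [walkWeight_id, Category.id_comp, Groupoid.comp_inv]
    rfl
  | pos y t γ a ih =>
    rw [walkWeight_comp, ih, walkWeight_of]
    refine congrArg (fun g : Pi1 V x₀ => (g : Pi1 V x₀ ⧸ relSubgroup B x₀)) ?_
    change (c x ≫ γ ≫ Groupoid.inv (c y)) ≫ c y ≫ (FreeGroupoid.of V).map a ≫
      Groupoid.inv (c t) = _
    simp
  | neg y t γ a ih =>
    rw [walkWeight_comp, ih, walkWeight_inv, walkWeight_of]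
    refine congrArg (fun g : Pi1 V x₀ => (g : Pi1 V x₀ ⧸ relSubgroup B x₀)) ?_
    change (c x ≫ γ ≫ Groupoid.inv (c y)) ≫ Groupoid.inv (c t ≫ (FreeGroupoid.of V).map a ≫
      Groupoid.inv (c y)) = _
    simp

theorem isConnectedQuiver_of_walks {x₀ : V} (c : ∀ x : V, WalkClass x₀ x) :
    IsConnectedQuiver V :=
  isConnectedQuiver_iff.2 ⟨⟨x₀⟩, fun x y => ⟨Groupoid.inv (c x) ≫ c y⟩⟩

theorem universalQuiver_isConnected : IsConnectedQuiver (UniversalQuiver B x₀ c) := by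
  refine isConnectedQuiver_iff.2 ⟨⟨⟨x₀, 1⟩⟩, fun X Y => ?_⟩
  obtain ⟨g, hg⟩ := QuotientGroup.mk_surjective (Y.deg * X.deg⁻¹)
  let γ : WalkClass X.vertex Y.vertex :=
    Groupoid.inv (c X.vertex) ≫ (g : WalkClass x₀ x₀) ≫ c Y.vertex
  have hγ : walkWeight (universalWeighting B x₀ c) γ = Y.deg * X.deg⁻¹ := by
    have hloop : c X.vertex ≫ γ ≫ Groupoid.inv (c Y.vertex) = (g : WalkClass x₀ x₀) := by
      simp [γ]
    rw [walkWeight_universalWeighting, hloop]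
    exact hg
  obtain ⟨γ', -⟩ := (exists_mapWalk_smashProj_eq_iff _ γ).2 (by rw [hγ, inv_mul_cancel_right])
  exact ⟨γ'⟩

variable {B}

theorem PathRel.pathWeight_eq {x y : V} {p q : Path x y} (h : PathRel B p q) :
    pathWeight (universalWeighting B x₀ c) p = pathWeight (universalWeighting B x₀ c) q := by
  have hone : walkWeight (universalWeighting B x₀ c)
      (pathClass q ≫ Groupoid.inv (pathClass p)) = 1 := by
    rw [walkWeight_universalWeighting]
    refine (QuotientGroup.eq_one_iff _).2 (Subgroup.subset_normalClosure ?_)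
    exact ⟨x, y, p, q, c x, h, by rw [Category.assoc]⟩
  rwa [walkWeight_comp, walkWeight_inv, inv_mul_eq_one, walkWeight_pathClass,
    walkWeight_pathClass] at hone

theorem IsMinimal.exists_hasWeight {x y : V} {b : PathCoalgebra k V} (hb : IsMinimal B x y b) :
    ∃ g, HasWeight (universalWeighting B x₀ c) g b := by
  have hends := (mem_homPart_iff.1 hb.mem).2
  obtain ⟨⟨x', y', p⟩, hp⟩ := Finset.card_pos.1 (Nat.two_pos.trans_le hb.two_le)
  obtain ⟨rfl, rfl⟩ := hends _ hp
  refine ⟨pathWeight (universalWeighting B x₀ c) p, ?_⟩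
  rintro ⟨s, t, q⟩ hq
  obtain ⟨hs, ht⟩ := hends _ hq
  dsimp only at hs ht
  subst hs ht
  by_cases hpq : q = p
  · rw [hpq]
  · exact PathRel.pathWeight_eq c ⟨hpq, b, hb, hq, hp⟩

theorem universalProj_isGaloisCoalgebraCovering (hB : IsSubcoalgebra B) :
    IsGaloisCoalgebraCovering (universalProj B x₀ c) (universalCover B x₀ c) B where
  toIsGaloisCovering :=
    smashProj_isGaloisCovering _ (isConnectedQuiver_of_walks c) (universalQuiver_isConnected B c)
  eq_liftSpan := smashCover_eq_liftSpan _ hB.isSumOfHomParts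
  lift_minimal _ _ _ hb _ hX := smashCover_lift_minimal _ hB.isSumOfHomParts hb
    (hb.exists_hasWeight c) hX

end UniversalWeighting

section UniversalLift

variable {k : Type z} [Field k] {V : Type u} [Quiver.{v} V]
  {B : Submodule k (PathCoalgebra k V)} {x₀ : V} {c : ∀ x : V, WalkClass x₀ x}
  {U : Type w} [Quiver.{w'} U] {F₁ : U ⥤q V} {B₁ : Submodule k (PathCoalgebra k U)}
  (h₁ : IsGaloisCoalgebraCovering F₁ B₁ B)
include h₁

theorem PathRel.transport_eq {x y : V} {p q : Path x y} (h : PathRel B p q) (u : Fiber F₁ x) :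
    transport h₁.isCovering (pathClass p) u = transport h₁.isCovering (pathClass q) u := by
  obtain ⟨-, b, hb, hp, hq⟩ := h
  obtain ⟨x', rfl⟩ := u
  obtain ⟨y', b', hb', rfl⟩ := h₁.lift_minimal _ _ _ hb x' rfl
  have hend : ∀ {r : Path (F₁.obj x') y}, toAll r ∈ supp (pathMap k F₁ b') →
      (transport h₁.isCovering (pathClass r) ⟨x', rfl⟩).1 = y' := by
    intro r hr
    obtain ⟨⟨s, t, r'⟩, hr', e⟩ := exists_of_mem_supp_pathMap hr
    obtain ⟨rfl, rfl⟩ := (mem_homPart_iff.1 hb'.mem).2 _ hr'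
    cases eq_of_heq (Sigma.mk.inj e).2
    rw [pathClass_mapPath, transport_mapWalk]
  exact Subtype.ext ((hend hp).trans (hend hq).symm)

theorem transport_eq_of_mem_relSubgroup {g : Pi1 V x₀} (hg : g ∈ relSubgroup B x₀)
    (u : Fiber F₁ x₀) : transport h₁.isCovering (g : WalkClass x₀ x₀) u = u := by
  let φ : Pi1 V x₀ →* Equiv.Perm (Fiber F₁ x₀) :=
    { toFun := fun g => transport h₁.isCovering (g : WalkClass x₀ x₀)
      map_one' := Equiv.ext (transport_id h₁.isCovering x₀)
      map_mul' := fun g h => Equiv.ext (transport_comp h₁.isCovering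
        (h : WalkClass x₀ x₀) (g : WalkClass x₀ x₀)) }
  suffices relSubgroup B x₀ ≤ φ.ker from Equiv.congr_fun (this hg) u
  refine Subgroup.normalClosure_le_normal ?_
  rintro _ ⟨x, y, p, q, w, hpq, rfl⟩
  refine Equiv.ext fun u => ?_
  change transport h₁.isCovering
    (w ≫ pathClass q ≫ Groupoid.inv (pathClass p) ≫ Groupoid.inv w) u = u
  rw [transport_comp, transport_comp, transport_comp, transport_inv, transport_inv,
    ← hpq.transport_eq h₁, Equiv.symm_apply_apply, Equiv.symm_apply_apply]

theorem transport_eq_of_walkWeight_eq_one {x : V} {β : WalkClass x x}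
    (hβ : walkWeight (universalWeighting B x₀ c) β = 1) (u : Fiber F₁ x) :
    transport h₁.isCovering β u = u := by
  rw [walkWeight_universalWeighting, QuotientGroup.eq_one_iff] at hβ
  have hfix := transport_eq_of_mem_relSubgroup h₁ hβ
    ((transport h₁.isCovering (c x)).symm u)
  change transport h₁.isCovering (c x ≫ β ≫ Groupoid.inv (c x)) _ = _ at hfix
  rw [transport_comp, transport_comp, Equiv.apply_symm_apply, transport_inv] at hfix
  exact Equiv.injective _ hfix

theorem exists_universalQuiver_lift (X : UniversalQuiver B x₀ c) {u : U}
    (hu : (universalProj B x₀ c).obj X = F₁.obj u) :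
    ∃ E : UniversalQuiver B x₀ c ⥤q U, E ⋙q F₁ = universalProj B x₀ c ∧ E.obj X = u :=
  exists_lift_of_transport_eq h₁.isCovering (universalQuiver_isConnected B c) ⟨u, hu.symm⟩
    fun γ => transport_eq_of_walkWeight_eq_one h₁
      (mul_eq_right.1 ((exists_mapWalk_smashProj_eq_iff _ _).1 ⟨γ, rfl⟩)) _

theorem isGaloisCoalgebraCovering_of_comp_eq_universalProj (hB : IsSubcoalgebra B)
    {E : UniversalQuiver B x₀ c ⥤q U} (hE : E ⋙q F₁ = universalProj B x₀ c) :
    IsGaloisCoalgebraCovering E (universalCover B x₀ c) B₁ := by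
  have h := universalProj_isGaloisCoalgebraCovering c hB
  rw [← hE] at h
  exact h.of_comp hB.isSumOfHomParts h₁ (h.toIsGaloisCovering.of_comp h₁.isCovering
    h₁.connected_source)

end UniversalLift

section CoveringsIsomorphic

variable {k : Type z} [Field k] {V : Type u} [Quiver.{v} V] {B : Submodule k (PathCoalgebra k V)}
  {W : Type*} [Quiver W] {F : W ⥤q V} {B' : Submodule k (PathCoalgebra k W)}
  {U : Type*} [Quiver U] {F₁ : U ⥤q V} {B₁ : Submodule k (PathCoalgebra k U)}

theorem IsGaloisCoalgebraCovering.isCoveringMorphism {E : W ⥤q U}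
    (hE : IsGaloisCoalgebraCovering E B' B₁) (hEF : E ⋙q F₁ = F) :
    IsCoveringMorphism F B' F₁ B₁ E :=
  ⟨hEF, fun _ => hE.pathMap_mem⟩

theorem IsCoveringMorphism.comp_eq_id {θ : W ⥤q U} {η : U ⥤q W}
    (hθ : IsCoveringMorphism F B' F₁ B₁ θ) (hη : IsCoveringMorphism F₁ B₁ F B' η)
    (hF : F.IsCovering) (hW : IsConnectedQuiver W) {x : W} (hx : η.obj (θ.obj x) = x) :
    θ ⋙q η = 𝟭q W := by
  refine eq_of_comp_eq_of_obj_eq hF hW ?_ hx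
  rw [Prefunctor.comp_assoc, hη.comp_eq, hθ.comp_eq, Prefunctor.id_comp]

theorem coveringsIsomorphic_of_obj_eq (h : IsGaloisCovering F) (h₁ : IsGaloisCovering F₁)
    {θ : W ⥤q U} {η : U ⥤q W} (hθ : IsCoveringMorphism F B' F₁ B₁ θ)
    (hη : IsCoveringMorphism F₁ B₁ F B' η) {u : U} (hu : θ.obj (η.obj u) = u) :
    CoveringsIsomorphic F B' F₁ B₁ :=
  ⟨θ, η, hθ, hη,
    hθ.comp_eq_id hη h.isCovering h.connected_source (x := η.obj u) (congrArg η.obj hu),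
    hη.comp_eq_id hθ h₁.isCovering h₁.connected_source hu⟩

end CoveringsIsomorphic

section Universality

variable {k : Type z} [Field k] {V : Type u} [Quiver.{v} V]
  {B : Submodule k (PathCoalgebra k V)} (hB : IsSubcoalgebra B) {x₀ : V}
  (c : ∀ x : V, WalkClass x₀ x)
include hB

theorem universalWeighting_isHomogeneousSub : IsHomogeneousSub (universalWeighting B x₀ c) B :=
  isHomogeneousSub_of_minimal hB.isSumOfHomParts fun _ _ _ hb => hb.exists_hasWeight c

theorem universalProj_isUniversalCovering :
    IsUniversalCovering.{w, w'} (universalProj B x₀ c) (universalCover B x₀ c) B := by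
  refine ⟨universalProj_isGaloisCoalgebraCovering c hB, fun U _ F₁ B₁ h₁ => ?_⟩
  obtain ⟨u⟩ := h₁.connected_source.1
  obtain ⟨E, hE, -⟩ := exists_universalQuiver_lift (c := c) h₁ ⟨F₁.obj u, 1⟩ rfl
  exact ⟨E, isGaloisCoalgebraCovering_of_comp_eq_universalProj h₁ hB hE, hE⟩

variable {c} {U : Type w} [Quiver.{w'} U] {F₁ : U ⥤q V} {B₁ : Submodule k (PathCoalgebra k U)}

theorem existsUnique_isGaloisCoalgebraCovering_lift (h₁ : IsGaloisCoalgebraCovering F₁ B₁ B)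
    {X : UniversalQuiver B x₀ c} {u : U} (hu : (universalProj B x₀ c).obj X = F₁.obj u) :
    ∃! E : UniversalQuiver B x₀ c ⥤q U,
      IsGaloisCoalgebraCovering E (universalCover B x₀ c) B₁ ∧
        E ⋙q F₁ = universalProj B x₀ c ∧ E.obj X = u := by
  obtain ⟨E, hE, hEX⟩ := exists_universalQuiver_lift h₁ X hu
  refine ⟨E, ⟨isGaloisCoalgebraCovering_of_comp_eq_universalProj h₁ hB hE, hE, hEX⟩, ?_⟩
  rintro E' ⟨-, hE', hEX'⟩
  exact eq_of_comp_eq_of_obj_eq h₁.isCovering (universalQuiver_isConnected B c)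
    (hE'.trans hE.symm) (hEX'.trans hEX.symm)

theorem coveringsIsomorphic_of_isUniversalCovering
    (h : IsUniversalCovering.{max u v, v} F₁ B₁ B) :
    CoveringsIsomorphic (universalProj B x₀ c) (universalCover B x₀ c) F₁ B₁ := by
  obtain ⟨h₁, huniv⟩ := h
  have hcov := universalProj_isGaloisCoalgebraCovering c hB
  obtain ⟨η, hη, hηF⟩ := huniv _ _ _ hcov
  obtain ⟨u⟩ := h₁.connected_source.1
  obtain ⟨θ, ⟨hθ, hθF, hθu⟩, -⟩ := existsUnique_isGaloisCoalgebraCovering_lift (u := u) hB h₁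
    (Prefunctor.congr_obj hηF u)
  exact coveringsIsomorphic_of_obj_eq hcov.toIsGaloisCovering h₁.toIsGaloisCovering
    (hθ.isCoveringMorphism hθF) (hη.isCoveringMorphism hηF) hθu

end Universality

end PathCoalg

end

theorem mainTheorem3_general {k : Type z} [Field k] {V : Type u} [Quiver.{v} V]
    (B : Submodule k (PathCoalgebra k V)) (hB : IsSubcoalgebra B)
    (x₀ : V) (c : ∀ x : V, WalkClass x₀ x) :
    IsHomogeneousSub (universalWeighting B x₀ c) B ∧
    IsSubcoalgebra (universalCover B x₀ c) ∧
    IsUniversalCovering.{w, w'} (universalProj B x₀ c) (universalCover B x₀ c) B ∧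
    (∀ (U : Type w) [Quiver.{w'} U] (F₁ : U ⥤q V) (B₁ : Submodule k (PathCoalgebra k U)),
      IsGaloisCoalgebraCovering F₁ B₁ B →
      ∀ (x' : UniversalQuiver B x₀ c) (x₁ : U), (universalProj B x₀ c).obj x' = F₁.obj x₁ →
        ∃! E : UniversalQuiver B x₀ c ⥤q U,
          IsGaloisCoalgebraCovering E (universalCover B x₀ c) B₁ ∧
            E ⋙q F₁ = universalProj B x₀ c ∧ E.obj x' = x₁) ∧
    (∀ (U : Type w) [Quiver.{w'} U] (F₁ : U ⥤q V) (B₁ : Submodule k (PathCoalgebra k U)),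
      IsUniversalCovering.{max u v, v} F₁ B₁ B →
        CoveringsIsomorphic (universalProj B x₀ c) (universalCover B x₀ c) F₁ B₁) := by
  have hhom := universalWeighting_isHomogeneousSub hB c
  refine ⟨hhom, smashCover_isSubcoalgebra _ hB hhom, universalProj_isUniversalCovering hB c, ?_, ?_⟩
  · intro U _ F₁ B₁ h₁ X u hu
    exact existsUnique_isGaloisCoalgebraCovering_lift hB h₁ hu
  · intro U _ F₁ B₁ h
    exact coveringsIsomorphic_of_isUniversalCovering hB h

theorem mainTheorem3 {k : Type z} [Field k] {V : Type u} [Quiver.{v} V]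
    (hV : IsConnectedQuiver V)
    (B : Submodule k (PathCoalgebra k V)) (hB : IsAdmissible B)
    (x₀ : V) (c : ∀ x : V, WalkClass x₀ x) :
    -- the smash coproduct exists: `B` is graded, and `B ⋊ (π₁ / N)` is an admissible subcoalgebra
    IsHomogeneousSub (universalWeighting B x₀ c) B ∧
    IsAdmissible (universalCover B x₀ c) ∧
    -- (a) it is a Galois coalgebra covering that factors all others
    IsUniversalCovering.{w, w'} (universalProj B x₀ c) (universalCover B x₀ c) B ∧
    -- (b) the factorization is unique once base points are fixed
    (∀ (U : Type w) [Quiver.{w'} U] (F₁ : U ⥤q V) (B₁ : Submodule k (PathCoalgebra k U)),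
      IsGaloisCoalgebraCovering F₁ B₁ B →
      ∀ (x' : UniversalQuiver B x₀ c) (x₁ : U), (universalProj B x₀ c).obj x' = F₁.obj x₁ →
        ∃! E : UniversalQuiver B x₀ c ⥤q U,
          IsGaloisCoalgebraCovering E (universalCover B x₀ c) B₁ ∧
            E ⋙q F₁ = universalProj B x₀ c ∧ E.obj x' = x₁) ∧
    -- (c) every covering with property (a) is isomorphic to it
    (∀ (U : Type w) [Quiver.{w'} U] (F₁ : U ⥤q V) (B₁ : Submodule k (PathCoalgebra k U)),
      IsUniversalCovering.{max u v, v} F₁ B₁ B →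
        CoveringsIsomorphic (universalProj B x₀ c) (universalCover B x₀ c) F₁ B₁) :=
  have ⟨hhom, _, huniv⟩ := mainTheorem3_general.{u, v, w, w', z} B hB.isSubcoalgebra x₀ c
  ⟨hhom, smashCover_isAdmissible _ hB hhom, huniv⟩
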